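/- Let $f:(\mathbb R^2,0)\to(\mathbb R^3,0)$ be a Whitney umbrella in normal form, that is, a $C^\infty$ map-germ $$f(u,v)=\Bigl(u,\;uv+\sum_{i=3}^k\frac{b_i}{i!}v^i+O(u,v)^{k+1},\;\sum_{m=2}^k\sum_{i+j=m}\frac{a_{ij}}{i!\,j!}u^iv^j+O(u,v)^{k+1}\Bigr),\qquad k\ge 3,\ a_{02}>0,$$ where $O(u,v)^{k+1}$ stands for a smooth function germ of order at least $k+1$ at the origin. For small $r>0$ consider the curve $\hat\gamma(\theta)=f(r\cos\theta,r\sin\theta)$ for $0<\theta<\pi$, and write $'=d/d\theta$. Let $\mathbf n=\frac{f_u\times f_v}{|f_u\times f_v|}$ be the unit normal of the surface along $\hat\gamma$, let $\hat\gamma'=l\,\mathbf e$ with $l=|\hat\gamma'|$ and $|\mathbf e|=1$, and let $\mathbf b=-\mathbf e\times\mathbf n$. Define $\kappa_1,\kappa_2,\kappa_3$ by $$\mathbf e'=\kappa_1\mathbf b+\kappa_2\mathbf n,\qquad \mathbf b'=-\kappa_1\mathbf e+\kappa_3\mathbf n,\qquad \mathbf n'=-\kappa_2\mathbf e-\kappa_3\mathbf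 b,$$ and put $\hat\kappa_i=l\kappa_i$ $(i=2,3)$ and $$\delta=\kappa_1(\hat\kappa_2^2+\hat\kappa_3^2)-\hat\kappa_2'\hat\kappa_3+\hat\kappa_2\hat\kappa_3'.$$ Here $\delta$ is the function whose non-vanishing says that the normal developable surface $\hat\gamma(\theta)+\beta\,\frac{\kappa_3\mathbf e-\kappa_2\mathbf b}{\sqrt{\kappa_2^2+\kappa_3^2}}$ is non-cylindrical. A function $F$ on $(0,\pi)$, not identically zero, is called a *first term* of a function $x(r,\theta)$ if, for some integer $i\ge0$ and some nowhere vanishing function $x_0$ on $(0,\pi)$, for each $\theta\in(0,\pi)$ one has $x(r,\theta)=F(\theta)x_0(\theta)r^i+O(r^{i+1})$ as $r\to0^+$. (The zero set of a first term depends only on $x$.) **Theorem.** The functions $$F_{\hat\kappa_2}(\theta)=\cos\theta\,\bigl(a_{02}\cos^2\theta+(2a_{02}+a_{20})\sin^2\theta\bigr),$$ $$\begin{aligned}F_\delta(\theta)={}&(1+a_{11}^2)(2a_{02}+a_{20})\cos^4\theta+2a_{02}a_{11}(2a_{02}+a_{20})\cos^3\theta\sin\theta\\&+\bigl(a_{02}^2(2a_{02}+a_{20})-(1+a_{11}^2)(a_{02}+2a_{20})\bigr)\cos^2\theta\sin^2\theta\\&-2a_{02}a_{11}(a_{02}+2a_{20})\cos\theta\sin^3\theta-a_{02}^2(a_{02}+2a_{20})\sin^4\theta\end{aligned}$$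 are first terms of $\hat\kappa_2$ and of $\delta$, respectively. Moreover, where "generically" means "for all $f$ whose coefficients $(a_{20},a_{11},a_{02})$ lie outside the zero set of some fixed nonzero real polynomial", the following hold for these, and for all other, first terms $F_{\hat\kappa_2}$ of $\hat\kappa_2$ and $F_\delta$ of $\delta$. 1. If $2a_{20}+a_{02}<0$, then generically the number of $\theta\in(0,\pi)\setminus\{\pi/2\}$ with $F_{\hat\kappa_2}(\theta)=0$ is $2$ or $0$. 2. If $2a_{02}+a_{20}\ne0$, then generically the number of $\theta\in(0,\pi)$ with $F_\delta(\theta)=0$ is $4$, $2$ or $0$ (it belongs to $\{0,2,4\}$). If $2a_{02}+a_{20}=0$, then $F_\delta(\theta)\neq0$ for every $\theta\in(0,\pi)$. -/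

import Mathlib

open Set Filter Topology Asymptotics
open scoped ContDiff Matrix Nat

noncomputable section

namespace WhitneyUmbrella

/-- A smooth function germ `R` at the origin of `ℝ²` belongs to `O(u,v)^m`: its order at the
origin is at least `m`, i.e. all its derivatives of order less than `m` vanish there. -/
def HasOrderGE (m : ℕ) (R : ℝ × ℝ → ℝ) : Prop :=
  ∀ j < m, iteratedFDeriv ℝ j R 0 = 0

/-- `f` is (a representative of) a Whitney umbrella in normal form, with coefficients `b i`
(`3 ≤ i ≤ k`) and `a i j` (`2 ≤ i + j ≤ k`):
`f(u,v) = (u, uv + B(v) + O(u,v)^(k+1), A_2(u,v) + ... + A_k(u,v) + O(u,v)^(k+1))` where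
`B(v) = ∑ b_i v^i / i!`, `A_m(u,v) = ∑_{i + j = m} a_{ij} u^i v^j / (i! j!)` and `a_{02} > 0`. -/
structure IsNormalForm (f : ℝ × ℝ → Fin 3 → ℝ) (k : ℕ) (b : ℕ → ℝ) (a : ℕ → ℕ → ℝ) : Prop where
  three_le : 3 ≤ k
  a02_pos : 0 < a 0 2
  smooth : ∃ U : Set (ℝ × ℝ), IsOpen U ∧ (0 : ℝ × ℝ) ∈ U ∧ ContDiffOn ℝ ∞ f U ∧
    ∀ p ∈ U, f p 0 = p.1
  second : HasOrderGE (k + 1) fun p : ℝ × ℝ =>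
    f p 1 - (p.1 * p.2 + ∑ i ∈ Finset.Icc 3 k, b i / (i ! : ℝ) * p.2 ^ i)
  third : HasOrderGE (k + 1) fun p : ℝ × ℝ =>
    f p 2 - ∑ m ∈ Finset.Icc 2 k, ∑ i ∈ Finset.range (m + 1),
      a i (m - i) / ((i ! : ℝ) * ((m - i)! : ℝ)) * p.1 ^ i * p.2 ^ (m - i)

/-- The Euclidean length of a vector of `ℝ³` (the norm instance on `Fin 3 → ℝ` is not used). -/
def len (v : Fin 3 → ℝ) : ℝ := √(v ⬝ᵥ v)

/-- The unit normal `f_u × f_v / |f_u × f_v|` of the surface `f`, at a regular point. -/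
def unitNormal (f : ℝ × ℝ → Fin 3 → ℝ) (p : ℝ × ℝ) : Fin 3 → ℝ :=
  (len (fderiv ℝ f p (1, 0) ⨯₃ fderiv ℝ f p (0, 1)))⁻¹ •
    (fderiv ℝ f p (1, 0) ⨯₃ fderiv ℝ f p (0, 1))

/-- The curve `θ ↦ f(r cos θ, r sin θ)` going around the umbrella. -/
def curve (f : ℝ × ℝ → Fin 3 → ℝ) (r θ : ℝ) : Fin 3 → ℝ :=
  f (r * Real.cos θ, r * Real.sin θ)

/-- The function `l` with `(f ∘ γ)' = l e`. -/
def speed (f : ℝ × ℝ → Fin 3 → ℝ) (r θ : ℝ) : ℝ :=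
  len (deriv (curve f r) θ)

/-- The unit tangent `e` of the curve. -/
def tangentVec (f : ℝ × ℝ → Fin 3 → ℝ) (r θ : ℝ) : Fin 3 → ℝ :=
  (speed f r θ)⁻¹ • deriv (curve f r) θ

/-- The unit vector field `n` along the curve: the unit normal of the surface. -/
def normalVec (f : ℝ × ℝ → Fin 3 → ℝ) (r θ : ℝ) : Fin 3 → ℝ :=
  unitNormal f (r * Real.cos θ, r * Real.sin θ)

/-- `b = - e × n`. -/
def binormalVec (f : ℝ × ℝ → Fin 3 → ℝ) (r θ : ℝ) : Fin 3 → ℝ :=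
  -(tangentVec f r θ ⨯₃ normalVec f r θ)

/-! The coefficients of the Frenet-Serre type formula of the orthonormal frame `e, b, n`:
`e' = κ₁ b + κ₂ n`, `b' = - κ₁ e + κ₃ n`, `n' = - κ₂ e - κ₃ b`, with `' = d/dθ`. -/

/-- `κ₁`. -/
def kappa1 (f : ℝ × ℝ → Fin 3 → ℝ) (r θ : ℝ) : ℝ :=
  deriv (tangentVec f r) θ ⬝ᵥ binormalVec f r θ

/-- `κ₂`. -/
def kappa2 (f : ℝ × ℝ → Fin 3 → ℝ) (r θ : ℝ) : ℝ :=
  deriv (tangentVec f r) θ ⬝ᵥ normalVec f r θ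

/-- `κ₃`. -/
def kappa3 (f : ℝ × ℝ → Fin 3 → ℝ) (r θ : ℝ) : ℝ :=
  deriv (binormalVec f r) θ ⬝ᵥ normalVec f r θ

/-- `κ̂₂ = l κ₂`. -/
def kappaHat2 (f : ℝ × ℝ → Fin 3 → ℝ) (r θ : ℝ) : ℝ := speed f r θ * kappa2 f r θ

/-- `κ̂₃ = l κ₃`. -/
def kappaHat3 (f : ℝ × ℝ → Fin 3 → ℝ) (r θ : ℝ) : ℝ := speed f r θ * kappa3 f r θ

/-- The function `δ` of the normal developable surface `f ∘ γ + β D`, where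
`D = (κ₃ e - κ₂ b) / √(κ₂² + κ₃²)`; the surface is non-cylindrical where `δ ≠ 0`. -/
def delta (f : ℝ × ℝ → Fin 3 → ℝ) (r θ : ℝ) : ℝ :=
  kappa1 f r θ * (kappaHat2 f r θ ^ 2 + kappaHat3 f r θ ^ 2)
    - deriv (kappaHat2 f r) θ * kappaHat3 f r θ + kappaHat2 f r θ * deriv (kappaHat3 f r) θ

/-- `F` is a first term of `x(r,θ)`, for `0 < θ < π` and `r → 0+`:
`x(r,θ) = F(θ) x₀(θ) r^i + O(r^(i+1))` for some `i` and some `x₀` that does not vanish anywhere.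
That `F` is not identically zero makes `r^i` the leading power, so that the zeros of a first
term depend on `x` only. -/
def IsFirstTerm (x : ℝ → ℝ → ℝ) (F : ℝ → ℝ) : Prop :=
  ∃ (i : ℕ) (x₀ : ℝ → ℝ), (∀ θ ∈ Ioo 0 Real.pi, x₀ θ ≠ 0) ∧ (∃ θ ∈ Ioo 0 Real.pi, F θ ≠ 0) ∧
    ∀ θ ∈ Ioo 0 Real.pi,
      (fun r : ℝ => x r θ - F θ * x₀ θ * r ^ i) =O[𝓝[>] 0] fun r : ℝ => r ^ (i + 1)

/-- The trigonometric polynomial `F_{κ̂₂}`. -/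
def FKappaHat2 (a20 a02 θ : ℝ) : ℝ :=
  Real.cos θ * (a02 * Real.cos θ ^ 2 + (2 * a02 + a20) * Real.sin θ ^ 2)

/-- The trigonometric polynomial `F_δ`. -/
def FDelta (a20 a11 a02 θ : ℝ) : ℝ :=
  (1 + a11 ^ 2) * (2 * a02 + a20) * Real.cos θ ^ 4
    + 2 * a02 * a11 * (2 * a02 + a20) * Real.cos θ ^ 3 * Real.sin θ
    + (a02 ^ 2 * (2 * a02 + a20) - (1 + a11 ^ 2) * (a02 + 2 * a20))
        * Real.cos θ ^ 2 * Real.sin θ ^ 2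
    - 2 * a02 * a11 * (a02 + 2 * a20) * Real.cos θ * Real.sin θ ^ 3
    - a02 ^ 2 * (a02 + 2 * a20) * Real.sin θ ^ 4

end WhitneyUmbrella

end

/-! Only the 2-jet of `f` matters. Along the circle of radius `r` the velocity `T` has components of
order `r, r², r²`, and the unnormalised normal `C = f_u × f_v` has components of order `r², r, r`.
Expressing `κ₁, κ̂₂, κ̂₃` through `T`, `C` and their angular derivatives and dividing out these
powers gives `κ̂₂ = r² · k2` and `δ = r³ · del`. Here `k2` and `del` are built from the rescaled
components by operations differentiable at the limit `r = 0`: there the rescaled normal has squared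
length `(a₁₁ cos θ + a₀₂ sin θ)² + cos² θ > 0`, and `sin θ ≠ 0`. Each rescaled component is its
limit plus `O(r)`, hence so are `k2` and `del` (`exists_near`). Their limits are `F_{κ̂₂}` and `F_δ`
up to nonvanishing factors (`second_limitJet`, `del_limitJet`).

The count of zeros rests on the factorisation `FDelta_eq`: `F_δ` is the positive quantity above
times `(2a₀₂ + a₂₀) cos² θ - (a₀₂ + 2a₂₀) sin² θ`. So the zeros of `F_δ`, like those of `F_{κ̂₂}`
away from `π/2`, are zeros of some `p cos² θ + q sin² θ`. For `q ≠ 0` this vanishes at two angles if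
`pq < 0` and at none otherwise (`encard_combination`). For `F_δ` the generic condition is `a₀₂ +
2a₂₀ ≠ 0`, and then the value 4 is not attained; for `F_{κ̂₂}` the constant polynomial 1 serves.

The passage to an arbitrary first term is `IsFirstTerm.eq_zero_iff`: the exponent of `r` is
determined by the function, and then so is the coefficient `F x₀`. -/

namespace WhitneyUmbrella

/-! ### Smooth functions of given order at the origin -/

/-- `R` is smooth on `U` and has order at least `m` at the origin. -/
structure OrdOn (U : Set (ℝ × ℝ)) (m : ℕ) (R : ℝ × ℝ → ℝ) : Prop where
  smooth : ContDiffOn ℝ ∞ R U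
  order : HasOrderGE m R

section OrdOn

variable {U : Set (ℝ × ℝ)} {m n : ℕ} {R S : ℝ × ℝ → ℝ}

theorem OrdOn.contDiffAt (h : OrdOn U m R) (hU : IsOpen U) {p : ℝ × ℝ} (hp : p ∈ U) :
    ContDiffAt ℝ ∞ R p :=
  h.smooth.contDiffAt (hU.mem_nhds hp)

theorem OrdOn.differentiableAt (h : OrdOn U m R) (hU : IsOpen U) {p : ℝ × ℝ} (hp : p ∈ U) :
    DifferentiableAt ℝ R p :=
  (h.contDiffAt hU hp).differentiableAt (by simp)

theorem OrdOn.mono (h : OrdOn U m R) (hn : n ≤ m) : OrdOn U n R :=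
  ⟨h.smooth, fun j hj => h.order j (hj.trans_le hn)⟩

theorem OrdOn.congr (h : OrdOn U m R) (hU : IsOpen U) (h0 : (0 : ℝ × ℝ) ∈ U)
    (hS : ∀ p ∈ U, S p = R p) : OrdOn U m S := by
  refine ⟨h.smooth.congr hS, fun j hj => ?_⟩
  have : S =ᶠ[𝓝 0] R := by filter_upwards [hU.mem_nhds h0] with p hp using hS p hp
  rw [(this.iteratedFDeriv ℝ j).self_of_nhds, h.order j hj]

theorem OrdOn.of_smooth (h : ContDiffOn ℝ ∞ R U) : OrdOn U 0 R :=
  ⟨h, fun _ hj => absurd hj (Nat.not_lt_zero _)⟩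

theorem OrdOn.add (hU : IsOpen U) (h0 : (0 : ℝ × ℝ) ∈ U) (hR : OrdOn U m R) (hS : OrdOn U m S) :
    OrdOn U m fun p => R p + S p := by
  refine ⟨hR.smooth.add hS.smooth, fun j hj => ?_⟩
  have := iteratedFDeriv_add_apply (𝕜 := ℝ) (i := j) (f := R) (g := S) (x := 0)
    ((hR.contDiffAt hU h0).of_le (by exact_mod_cast le_top))
    ((hS.contDiffAt hU h0).of_le (by exact_mod_cast le_top))
  rw [hR.order j hj, hS.order j hj, add_zero] at this
  exact this

/-- By Leibniz, every term of a derivative of order below `m + n` contains a derivative of `R` of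
order below `m` or one of `S` of order below `n`. -/
theorem OrdOn.mul (hU : IsOpen U) (h0 : (0 : ℝ × ℝ) ∈ U) (hR : OrdOn U m R) (hS : OrdOn U n S) :
    OrdOn U (m + n) fun p => R p * S p := by
  refine ⟨hR.smooth.mul hS.smooth, fun j hj => ?_⟩
  have key := norm_iteratedFDerivWithin_mul_le (n := j) hR.smooth hS.smooth hU.uniqueDiffOn h0
    (by exact_mod_cast le_top)
  simp only [iteratedFDerivWithin_of_isOpen _ hU h0] at key
  rw [← norm_le_zero_iff]
  refine key.trans (le_of_eq (Finset.sum_eq_zero fun i hi => ?_))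
  rw [Finset.mem_range] at hi
  by_cases him : i < m
  · rw [hR.order i him]; simp
  · rw [hS.order (j - i) (by omega)]; simp

theorem OrdOn.const (c : ℝ) : OrdOn U 0 fun _ => c :=
  .of_smooth contDiffOn_const

theorem OrdOn.const_mul (hU : IsOpen U) (h0 : (0 : ℝ × ℝ) ∈ U) (c : ℝ) (hR : OrdOn U m R) :
    OrdOn U m fun p => c * R p := by
  simpa using (OrdOn.const (U := U) c).mul hU h0 hR

theorem OrdOn.sub (hU : IsOpen U) (h0 : (0 : ℝ × ℝ) ∈ U) (hR : OrdOn U m R) (hS : OrdOn U m S) :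
    OrdOn U m fun p => R p - S p := by
  simpa [sub_eq_add_neg] using hR.add hU h0 (hS.const_mul hU h0 (-1))

theorem OrdOn.sum (hU : IsOpen U) (h0 : (0 : ℝ × ℝ) ∈ U) {ι : Type*} (s : Finset ι)
    {R : ι → ℝ × ℝ → ℝ} (h : ∀ i ∈ s, OrdOn U m (R i)) : OrdOn U m fun p => ∑ i ∈ s, R i p := by
  classical
  induction s using Finset.induction_on with
  | empty =>
    refine ⟨by simpa using contDiffOn_const, fun j _ => ?_⟩
    simp
  | insert i s hi ih =>
    simp only [Finset.sum_insert hi]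
    exact (h i (by simp)).add hU h0 (ih fun k hk => h k (by simp [hk]))

theorem OrdOn.fst : OrdOn U 1 fun p => p.1 := by
  refine ⟨contDiff_fst.contDiffOn, fun j hj => ?_⟩
  obtain rfl : j = 0 := by omega
  ext; simp

theorem OrdOn.snd : OrdOn U 1 fun p => p.2 := by
  refine ⟨contDiff_snd.contDiffOn, fun j hj => ?_⟩
  obtain rfl : j = 0 := by omega
  ext; simp

theorem OrdOn.pow (hU : IsOpen U) (h0 : (0 : ℝ × ℝ) ∈ U) (hR : OrdOn U 1 R) (i : ℕ) :
    OrdOn U i fun p => R p ^ i := by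
  induction i with
  | zero => simpa using OrdOn.const (U := U) 1
  | succ i ih => simpa [pow_succ] using ih.mul hU h0 hR

theorem OrdOn.fderiv_apply (hU : IsOpen U) (h0 : (0 : ℝ × ℝ) ∈ U) (hR : OrdOn U (m + 1) R)
    (v : ℝ × ℝ) : OrdOn U m fun p => fderiv ℝ R p v := by
  have hs : ContDiffOn ℝ ∞ (fderiv ℝ R) U := hR.smooth.fderiv_of_isOpen hU (by simp)
  refine ⟨hs.clm_apply contDiffOn_const, fun j hj => ?_⟩
  rw [← norm_le_zero_iff]
  refine (norm_iteratedFDeriv_clm_apply_const (hs.contDiffAt (hU.mem_nhds h0))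
    (by exact_mod_cast le_top)).trans (le_of_eq ?_)
  rw [norm_iteratedFDeriv_fderiv, hR.order (j + 1) (by omega)]
  simp

/-- Induction on the order: the partial derivatives are `O(‖p‖^m)`, hence so is the differential,
and the mean value inequality on the ball of radius `‖p‖` supplies one more factor `‖p‖`. -/
theorem OrdOn.isBigO (hU : IsOpen U) (h0 : (0 : ℝ × ℝ) ∈ U) (hR : OrdOn U m R) :
    R =O[𝓝 0] fun p => ‖p‖ ^ m := by
  induction m generalizing R with
  | zero => simpa using (hR.contDiffAt hU h0).continuousAt.isBigO_one ℝ
  | succ m ih =>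
    have hd : (fun p => fderiv ℝ R p) =O[𝓝 0] fun p => ‖p‖ ^ m := by
      have h1 := ih (hR.fderiv_apply hU h0 (1, 0))
      have h2 := ih (hR.fderiv_apply hU h0 (0, 1))
      refine IsBigO.trans (IsBigO.of_bound 1 (Eventually.of_forall fun p => ?_))
        (h1.norm_left.add h2.norm_left)
      rw [one_mul, Real.norm_of_nonneg (by positivity)]
      refine ContinuousLinearMap.opNorm_le_bound _ (by positivity) fun q => ?_
      have : q = q.1 • ((1 : ℝ), (0 : ℝ)) + q.2 • ((0 : ℝ), (1 : ℝ)) := by ext <;> simp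
      conv_lhs => rw [this, map_add, map_smul, map_smul]
      refine (norm_add_le _ _).trans ?_
      rw [norm_smul, norm_smul, add_mul, mul_comm _ ‖q‖, mul_comm _ ‖q‖]
      gcongr
      · exact norm_fst_le q
      · exact norm_snd_le q
    obtain ⟨c, hc⟩ := hd.bound
    obtain ⟨ε, hε, hball⟩ := Metric.eventually_nhds_iff_ball.1 (hc.and (hU.mem_nhds h0))
    refine IsBigO.of_bound c ?_
    filter_upwards [Metric.ball_mem_nhds _ hε] with p hp
    have hR0 : R 0 = 0 := by
      have := hR.order 0 (by omega)
      have := congrArg (fun L => L 0) this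
      simpa using this
    have hsub : Metric.closedBall (0 : ℝ × ℝ) ‖p‖ ⊆ Metric.ball 0 ε :=
      Metric.closedBall_subset_ball (by simpa using hp)
    have hc0 : 0 ≤ c * ‖p‖ ^ m := (norm_nonneg _).trans (by simpa using (hball p hp).1)
    have := (convex_closedBall (0 : ℝ × ℝ) ‖p‖).norm_image_sub_le_of_norm_fderiv_le (𝕜 := ℝ)
      (f := R) (C := c * ‖p‖ ^ m) (x := 0) (y := p)
      (fun q hq => hR.differentiableAt hU (hball q (hsub hq)).2)
      (fun q hq => ?_) (by simp) (by simp)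
    · rw [hR0, sub_zero, sub_zero] at this
      simpa [pow_succ, mul_assoc] using this
    · refine (hball q (hsub hq)).1.trans ?_
      have hq' : ‖q‖ ≤ ‖p‖ := by simpa using hq
      have h1 : 0 ≤ c * ‖q‖ ^ m := (norm_nonneg _).trans (by simpa using (hball q (hsub hq)).1)
      rw [norm_pow, norm_norm]
      -- The constant `c` is not known to be nonnegative; the bound at `q` forces this only when
      -- `‖q‖ ^ m ≠ 0`.
      rcases eq_or_ne (‖q‖ ^ m) 0 with h | h
      · rw [h, mul_zero]; exact hc0
      · have : 0 ≤ c := nonneg_of_mul_nonneg_left h1 (lt_of_le_of_ne (by positivity) h.symm)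
        gcongr

/-! ### Angular derivatives and restriction to circles -/

/-- The angular derivative `- v ∂_u + u ∂_v`. -/
noncomputable def rot (H : ℝ × ℝ → ℝ) (p : ℝ × ℝ) : ℝ :=
  -p.2 * fderiv ℝ H p (1, 0) + p.1 * fderiv ℝ H p (0, 1)

/-- Differentiation costs one order and the factor `u` or `v` restores it, so angular derivatives
can be iterated without loss. -/
theorem OrdOn.rot (hU : IsOpen U) (h0 : (0 : ℝ × ℝ) ∈ U) (hR : OrdOn U (m + 1) R) :
    OrdOn U (m + 1) (rot R) := by
  have h1 := (OrdOn.snd (U := U)).mul hU h0 (hR.fderiv_apply hU h0 (1, 0))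
  have h2 := (OrdOn.fst (U := U)).mul hU h0 (hR.fderiv_apply hU h0 (0, 1))
  rw [add_comm m 1]
  refine (h2.sub hU h0 h1).congr hU h0 fun p _ => ?_
  simp only [WhitneyUmbrella.rot]
  ring

theorem rot_sub {p : ℝ × ℝ} (hR : DifferentiableAt ℝ R p) (hS : DifferentiableAt ℝ S p) :
    rot (fun q => R q - S q) p = rot R p - rot S p := by
  simp only [rot, fderiv_fun_sub hR hS, _root_.sub_apply]
  ring

/-- Polar coordinates. -/
noncomputable def polar (r θ : ℝ) : ℝ × ℝ := (r * Real.cos θ, r * Real.sin θ)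

theorem hasDerivAt_polar (r θ : ℝ) :
    HasDerivAt (polar r) (-(r * Real.sin θ), r * Real.cos θ) θ := by
  have h1 := (Real.hasDerivAt_cos θ).const_mul r
  have h2 := (Real.hasDerivAt_sin θ).const_mul r
  rw [mul_neg] at h1
  exact h1.prodMk h2

theorem fderiv_polar (f : ℝ × ℝ → ℝ) (r θ : ℝ) :
    fderiv ℝ f (polar r θ) (-(r * Real.sin θ), r * Real.cos θ) = rot f (polar r θ) := by
  have : ((-(r * Real.sin θ), r * Real.cos θ) : ℝ × ℝ) =
      (-(r * Real.sin θ)) • ((1 : ℝ), (0 : ℝ)) + (r * Real.cos θ) • ((0 : ℝ), (1 : ℝ)) := by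
    ext <;> simp
  rw [this, map_add, map_smul, map_smul]
  simp [rot, polar]

theorem hasDerivAt_comp_polar {f : ℝ × ℝ → ℝ} {r θ : ℝ}
    (hf : DifferentiableAt ℝ f (polar r θ)) :
    HasDerivAt (fun t => f (polar r t)) (rot f (polar r θ)) θ := by
  rw [← fderiv_polar]
  exact hf.hasFDerivAt.comp_hasDerivAt θ (hasDerivAt_polar r θ)

theorem norm_polar_le {r : ℝ} (hr : 0 ≤ r) (θ : ℝ) : ‖polar r θ‖ ≤ r := by
  refine max_le ?_ ?_
  · simpa [polar, abs_mul, abs_of_nonneg hr] using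
      mul_le_of_le_one_right hr (Real.abs_cos_le_one θ)
  · simpa [polar, abs_mul, abs_of_nonneg hr] using
      mul_le_of_le_one_right hr (Real.abs_sin_le_one θ)

theorem OrdOn.isBigO_polar (hU : IsOpen U) (h0 : (0 : ℝ × ℝ) ∈ U) (hR : OrdOn U m R) (θ : ℝ) :
    (fun r => R (polar r θ)) =O[𝓝[>] 0] fun r : ℝ => r ^ m := by
  have ht : Tendsto (fun r => polar r θ) (𝓝[>] 0) (𝓝 0) := by
    refine tendsto_nhdsWithin_of_tendsto_nhds ?_
    have : Continuous fun r => polar r θ := by unfold polar; fun_prop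
    have := this.tendsto 0
    rwa [show polar 0 θ = 0 by ext <;> simp [polar]] at this
  refine ((hR.isBigO hU h0).comp_tendsto ht).trans (IsBigO.of_bound 1 ?_)
  filter_upwards [self_mem_nhdsWithin] with r hr
  have hr : 0 < r := hr
  have := norm_polar_le hr.le θ
  simp only [Function.comp, norm_pow, norm_norm, one_mul, Real.norm_of_nonneg hr.le]
  gcongr

/-! ### Linear and quadratic leading forms -/

/-- `H` is the linear form `a u + b v` up to terms of order two. -/
def IsLin (U : Set (ℝ × ℝ)) (H : ℝ × ℝ → ℝ) (a b : ℝ) : Prop :=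
  OrdOn U 2 fun p => H p - (a * p.1 + b * p.2)

/-- `H` is the quadratic form `a u² + b u v + c v²` up to terms of order three. -/
def IsQuad (U : Set (ℝ × ℝ)) (H : ℝ × ℝ → ℝ) (a b c : ℝ) : Prop :=
  OrdOn U 3 fun p => H p - (a * p.1 ^ 2 + b * (p.1 * p.2) + c * p.2 ^ 2)

theorem hasFDerivAt_lin (a b : ℝ) (p : ℝ × ℝ) :
    HasFDerivAt (fun p : ℝ × ℝ => a * p.1 + b * p.2)
      (a • ContinuousLinearMap.fst ℝ ℝ ℝ + b • ContinuousLinearMap.snd ℝ ℝ ℝ) p := by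
  have h1 : HasFDerivAt (fun p : ℝ × ℝ => p.1) (ContinuousLinearMap.fst ℝ ℝ ℝ) p := hasFDerivAt_fst
  have h2 : HasFDerivAt (fun p : ℝ × ℝ => p.2) (ContinuousLinearMap.snd ℝ ℝ ℝ) p := hasFDerivAt_snd
  exact (h1.const_mul a).add (h2.const_mul b)

theorem hasFDerivAt_quad (a b c : ℝ) (p : ℝ × ℝ) :
    HasFDerivAt (fun p : ℝ × ℝ => a * p.1 ^ 2 + b * (p.1 * p.2) + c * p.2 ^ 2)
      ((2 * a * p.1 + b * p.2) • ContinuousLinearMap.fst ℝ ℝ ℝ +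
        (b * p.1 + 2 * c * p.2) • ContinuousLinearMap.snd ℝ ℝ ℝ) p := by
  have h1 : HasFDerivAt (fun p : ℝ × ℝ => p.1) (ContinuousLinearMap.fst ℝ ℝ ℝ) p := hasFDerivAt_fst
  have h2 : HasFDerivAt (fun p : ℝ × ℝ => p.2) (ContinuousLinearMap.snd ℝ ℝ ℝ) p := hasFDerivAt_snd
  refine ((((h1.pow 2).const_mul a).add ((h1.mul h2).const_mul b)).add
    ((h2.pow 2).const_mul c)).congr_fderiv ?_
  ext <;> simp <;> ring

theorem IsLin.ordOn (hU : IsOpen U) (h0 : (0 : ℝ × ℝ) ∈ U) {H : ℝ × ℝ → ℝ} {a b : ℝ}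
    (h : IsLin U H a b) : OrdOn U 1 H := by
  have h1 := ((OrdOn.fst (U := U)).const_mul hU h0 a).add hU h0
    ((OrdOn.snd (U := U)).const_mul hU h0 b)
  refine ((h.mono one_le_two).add hU h0 h1).congr hU h0 fun p _ => by ring

theorem IsQuad.ordOn (hU : IsOpen U) (h0 : (0 : ℝ × ℝ) ∈ U) {H : ℝ × ℝ → ℝ} {a b c : ℝ}
    (h : IsQuad U H a b c) : OrdOn U 2 H := by
  have hx := OrdOn.fst (U := U)
  have hy := OrdOn.snd (U := U)
  have h1 := (((hx.pow hU h0 2).const_mul hU h0 a).add hU h0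
    ((hx.mul hU h0 hy).const_mul hU h0 b)).add hU h0 ((hy.pow hU h0 2).const_mul hU h0 c)
  exact ((h.mono (Nat.le_succ 2)).add hU h0 h1).congr hU h0 fun p _ => by ring

variable {H K : ℝ × ℝ → ℝ} {a b c d : ℝ}

theorem IsLin.rot (hU : IsOpen U) (h0 : (0 : ℝ × ℝ) ∈ U) (h : IsLin U H a b) :
    IsLin U (rot H) b (-a) := by
  refine (OrdOn.rot hU h0 h).congr hU h0 fun p hp => ?_
  rw [rot_sub ((h.ordOn hU h0).differentiableAt hU hp) (hasFDerivAt_lin a b p).differentiableAt]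
  simp only [WhitneyUmbrella.rot, (hasFDerivAt_lin a b p).fderiv]
  simp
  ring

theorem IsQuad.rot (hU : IsOpen U) (h0 : (0 : ℝ × ℝ) ∈ U) (h : IsQuad U H a b c) :
    IsQuad U (rot H) b (2 * c - 2 * a) (-b) := by
  refine (OrdOn.rot hU h0 h).congr hU h0 fun p hp => ?_
  rw [rot_sub ((h.ordOn hU h0).differentiableAt hU hp)
    (hasFDerivAt_quad a b c p).differentiableAt]
  simp only [WhitneyUmbrella.rot, (hasFDerivAt_quad a b c p).fderiv]
  simp
  ring

theorem IsQuad.fderiv_fst (hU : IsOpen U) (h0 : (0 : ℝ × ℝ) ∈ U) (h : IsQuad U H a b c) :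
    IsLin U (fun p => fderiv ℝ H p (1, 0)) (2 * a) b := by
  refine (OrdOn.fderiv_apply hU h0 h (1, 0)).congr hU h0 fun p hp => ?_
  rw [fderiv_fun_sub ((h.ordOn hU h0).differentiableAt hU hp)
    (hasFDerivAt_quad a b c p).differentiableAt, (hasFDerivAt_quad a b c p).fderiv]
  simp

theorem IsQuad.fderiv_snd (hU : IsOpen U) (h0 : (0 : ℝ × ℝ) ∈ U) (h : IsQuad U H a b c) :
    IsLin U (fun p => fderiv ℝ H p (0, 1)) b (2 * c) := by
  refine (OrdOn.fderiv_apply hU h0 h (0, 1)).congr hU h0 fun p hp => ?_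
  rw [fderiv_fun_sub ((h.ordOn hU h0).differentiableAt hU hp)
    (hasFDerivAt_quad a b c p).differentiableAt, (hasFDerivAt_quad a b c p).fderiv]
  simp

/-- With linear parts `L` and `M`, `HK - LM = (H - L)K + L(K - M)`, and both summands have order at
least `2 + 1`. -/
theorem IsLin.mul (hU : IsOpen U) (h0 : (0 : ℝ × ℝ) ∈ U) (h : IsLin U H a b)
    (hK : IsLin U K c d) : IsQuad U (fun p => H p * K p) (a * c) (a * d + b * c) (b * d) := by
  have hx := OrdOn.fst (U := U)
  have hy := OrdOn.snd (U := U)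
  have h1 := OrdOn.mul hU h0 h (hK.ordOn hU h0)
  have h2 := OrdOn.mul hU h0 ((hx.const_mul hU h0 a).add hU h0 (hy.const_mul hU h0 b)) hK
  exact (h1.add hU h0 h2).congr hU h0 fun p _ => by ring

theorem IsLin.neg (hU : IsOpen U) (h0 : (0 : ℝ × ℝ) ∈ U) (h : IsLin U H a b) :
    IsLin U (fun p => -H p) (-a) (-b) :=
  (OrdOn.const_mul hU h0 (-1) h).congr hU h0 fun p _ => by ring

theorem IsQuad.sub {a' b' c' : ℝ} (hU : IsOpen U) (h0 : (0 : ℝ × ℝ) ∈ U) (h : IsQuad U H a b c)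
    (hK : IsQuad U K a' b' c') : IsQuad U (fun p => H p - K p) (a - a') (b - b') (c - c') :=
  (OrdOn.sub hU h0 h hK).congr hU h0 fun p _ => by ring

theorem IsLin.isBigO (hU : IsOpen U) (h0 : (0 : ℝ × ℝ) ∈ U) (h : IsLin U H a b) (θ : ℝ) :
    (fun r => H (polar r θ) / r - (a * Real.cos θ + b * Real.sin θ)) =O[𝓝[>] 0]
      fun r : ℝ => r := by
  have h1 := (OrdOn.isBigO_polar hU h0 h θ).mul (isBigO_refl (fun r : ℝ => r⁻¹) (𝓝[>] 0))
  refine h1.congr' ?_ ?_ <;> filter_upwards [self_mem_nhdsWithin] with r hr <;>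
    have hr : r ≠ 0 := ne_of_gt hr
  · simp only [polar]; field_simp
  · field_simp

theorem IsQuad.isBigO (hU : IsOpen U) (h0 : (0 : ℝ × ℝ) ∈ U) (h : IsQuad U H a b c) (θ : ℝ) :
    (fun r => H (polar r θ) / r ^ 2 - (a * Real.cos θ ^ 2 + b * (Real.cos θ * Real.sin θ)
      + c * Real.sin θ ^ 2)) =O[𝓝[>] 0] fun r : ℝ => r := by
  have h1 := (OrdOn.isBigO_polar hU h0 h θ).mul (isBigO_refl (fun r : ℝ => (r ^ 2)⁻¹) (𝓝[>] 0))
  refine h1.congr' ?_ ?_ <;> filter_upwards [self_mem_nhdsWithin] with r hr <;>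
    have hr : r ≠ 0 := ne_of_gt hr
  · simp only [polar]; field_simp
  · field_simp

end OrdOn

/-! ### The invariants of the frame -/

section Frame

theorem len_sq (v : Fin 3 → ℝ) : len v ^ 2 = v ⬝ᵥ v :=
  Real.sq_sqrt (by simpa using dotProduct_star_self_nonneg v)

theorem hasDerivAt_dot {T C : ℝ → Fin 3 → ℝ} {T₁ C₁ : Fin 3 → ℝ} {θ : ℝ} (hT : HasDerivAt T T₁ θ)
    (hC : HasDerivAt C C₁ θ) :
    HasDerivAt (fun t => T t ⬝ᵥ C t) (T₁ ⬝ᵥ C θ + T θ ⬝ᵥ C₁) θ := by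
  rw [hasDerivAt_pi] at hT hC
  simp only [dotProduct, ← Finset.sum_add_distrib]
  exact HasDerivAt.fun_sum fun i _ => (hT i).mul (hC i)

theorem hasDerivAt_cross {T C : ℝ → Fin 3 → ℝ} {T₁ C₁ : Fin 3 → ℝ} {θ : ℝ}
    (hT : HasDerivAt T T₁ θ) (hC : HasDerivAt C C₁ θ) :
    HasDerivAt (fun t => T t ⨯₃ C t) (T₁ ⨯₃ C θ + T θ ⨯₃ C₁) θ := by
  rw [hasDerivAt_pi] at hT hC ⊢
  intro i
  fin_cases i
  · exact (((hT 1).mul (hC 2)).sub ((hT 2).mul (hC 1))).congr_deriv (by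
      simp [cross_apply]; ring)
  · exact (((hT 2).mul (hC 0)).sub ((hT 0).mul (hC 2))).congr_deriv (by
      simp [cross_apply]; ring)
  · exact (((hT 0).mul (hC 1)).sub ((hT 1).mul (hC 0))).congr_deriv (by
      simp [cross_apply]; ring)

/-- The coefficient `α` is left unspecified: the component along `T θ` drops out of every product in
which this derivative is used. -/
theorem hasDerivAt_normalize {T : ℝ → Fin 3 → ℝ} {T₁ : Fin 3 → ℝ} {θ : ℝ}
    (hT : HasDerivAt T T₁ θ) (h0 : T θ ⬝ᵥ T θ ≠ 0) :
    ∃ α : ℝ, HasDerivAt (fun t => (len (T t))⁻¹ • T t) ((len (T θ))⁻¹ • T₁ + α • T θ) θ := by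
  have hne : len (T θ) ≠ 0 := fun h => h0 (by rw [← len_sq, h]; simp)
  exact ⟨_, (((hasDerivAt_dot hT hT).sqrt h0).inv hne).smul hT⟩

/-- The normal `f_u × f_v` along the curve. -/
noncomputable def crossVec (f : ℝ × ℝ → Fin 3 → ℝ) (r θ : ℝ) : Fin 3 → ℝ :=
  fderiv ℝ f (polar r θ) (1, 0) ⨯₃ fderiv ℝ f (polar r θ) (0, 1)

variable {f : ℝ × ℝ → Fin 3 → ℝ} {r θ : ℝ} {T₁ C₁ : Fin 3 → ℝ}

theorem kappa1_eq (hT : HasDerivAt (deriv (curve f r)) T₁ θ)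
    (hT0 : deriv (curve f r) θ ⬝ᵥ deriv (curve f r) θ ≠ 0) :
    kappa1 f r θ = -(T₁ ⬝ᵥ (deriv (curve f r) θ ⨯₃ crossVec f r θ)) /
      ((deriv (curve f r) θ ⬝ᵥ deriv (curve f r) θ) * len (crossVec f r θ)) := by
  obtain ⟨α, hα⟩ := hasDerivAt_normalize hT hT0
  have h1 : deriv (tangentVec f r) θ = _ := hα.deriv
  have h2 : normalVec f r θ = (len (crossVec f r θ))⁻¹ • crossVec f r θ := rfl
  rw [kappa1, h1, binormalVec, h2, tangentVec, speed, ← len_sq]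
  simp only [dotProduct, cross_apply, Fin.sum_univ_three, Pi.add_apply, Pi.smul_apply,
    smul_eq_mul, Pi.neg_apply, Matrix.cons_val, div_eq_mul_inv, mul_inv]
  ring

theorem kappa2_eq (hT : HasDerivAt (deriv (curve f r)) T₁ θ)
    (hT0 : deriv (curve f r) θ ⬝ᵥ deriv (curve f r) θ ≠ 0)
    (ho : deriv (curve f r) θ ⬝ᵥ crossVec f r θ = 0) :
    speed f r θ * kappa2 f r θ = T₁ ⬝ᵥ crossVec f r θ / len (crossVec f r θ) := by
  obtain ⟨α, hα⟩ := hasDerivAt_normalize hT hT0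
  have hne : speed f r θ ≠ 0 := fun h => hT0 (by rw [← len_sq]; change speed f r θ ^ 2 = 0; simp [h])
  have h1 : deriv (tangentVec f r) θ = _ := hα.deriv
  have h2 : normalVec f r θ = (len (crossVec f r θ))⁻¹ • crossVec f r θ := rfl
  rw [kappa2, h1, h2, add_dotProduct, smul_dotProduct, smul_dotProduct, dotProduct_smul,
    dotProduct_smul, ho]
  change speed f r θ * ((speed f r θ)⁻¹ • _ + _) = _
  simp only [smul_eq_mul]
  field_simp
  ring

/-- In `b' = -(e' × n + e × n')` the first term is orthogonal to `n`. In the second, the part of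
`n'` along `C` contributes nothing, and the factor `l` cancels the normalisation of `e`. -/
theorem kappa3_eq (hT : HasDerivAt (deriv (curve f r)) T₁ θ)
    (hC : HasDerivAt (crossVec f r) C₁ θ)
    (hT0 : deriv (curve f r) θ ⬝ᵥ deriv (curve f r) θ ≠ 0)
    (hC0 : crossVec f r θ ⬝ᵥ crossVec f r θ ≠ 0) :
    speed f r θ * kappa3 f r θ = -((deriv (curve f r) θ ⨯₃ C₁) ⬝ᵥ crossVec f r θ) /
      (crossVec f r θ ⬝ᵥ crossVec f r θ) := by
  obtain ⟨α, hα⟩ := hasDerivAt_normalize hT hT0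
  obtain ⟨β, hβ⟩ := hasDerivAt_normalize hC hC0
  have hne : speed f r θ ≠ 0 := fun h => hT0 (by rw [← len_sq]; change speed f r θ ^ 2 = 0; simp [h])
  have h1 : deriv (binormalVec f r) θ = _ := (hasDerivAt_cross hα hβ).neg.deriv
  have h2 : normalVec f r θ = (len (crossVec f r θ))⁻¹ • crossVec f r θ := rfl
  have h3 : len (deriv (curve f r) θ) = speed f r θ := rfl
  rw [kappa3, h1, h2, h3, ← len_sq, eq_comm]
  -- The factor `l · l⁻¹` is kept on both sides, which leaves a polynomial identity in the
  -- components and the inverse lengths.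
  have h4 : -((deriv (curve f r) θ ⨯₃ C₁) ⬝ᵥ crossVec f r θ) / len (crossVec f r θ) ^ 2 =
    (speed f r θ * (speed f r θ)⁻¹) *
      (-((deriv (curve f r) θ ⨯₃ C₁) ⬝ᵥ crossVec f r θ) * (len (crossVec f r θ))⁻¹ ^ 2) := by
    rw [mul_inv_cancel₀ hne, one_mul, inv_pow, div_eq_mul_inv]
  rw [h4]
  simp only [dotProduct, cross_apply, Fin.sum_univ_three, Pi.add_apply, Pi.smul_apply,
    smul_eq_mul, Pi.neg_apply, Matrix.cons_val]
  ring

end Frame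

/-! ### The invariants in coordinates -/

/-- Coordinates `![-r sin, A, B]` of the velocity of the curve and `![X, Y, Z]` of `f_u × f_v`, with
derivatives. -/
structure FrameData (f : ℝ × ℝ → Fin 3 → ℝ) (r : ℝ)
    (A A₁ A₂ B B₁ B₂ X X₁ X₂ Y Y₁ Y₂ Z Z₁ Z₂ : ℝ → ℝ) : Prop where
  velocity : ∀ t, deriv (curve f r) t = ![-(r * Real.sin t), A t, B t]
  cross : ∀ t, crossVec f r t = ![X t, Y t, Z t]
  orth : ∀ t, -(r * Real.sin t) * X t + A t * Y t + B t * Z t = 0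
  A' : ∀ t, HasDerivAt A (A₁ t) t
  A'' : ∀ t, HasDerivAt A₁ (A₂ t) t
  B' : ∀ t, HasDerivAt B (B₁ t) t
  B'' : ∀ t, HasDerivAt B₁ (B₂ t) t
  X' : ∀ t, HasDerivAt X (X₁ t) t
  X'' : ∀ t, HasDerivAt X₁ (X₂ t) t
  Y' : ∀ t, HasDerivAt Y (Y₁ t) t
  Y'' : ∀ t, HasDerivAt Y₁ (Y₂ t) t
  Z' : ∀ t, HasDerivAt Z (Z₁ t) t
  Z'' : ∀ t, HasDerivAt Z₁ (Z₂ t) t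

namespace FrameData

variable {f : ℝ × ℝ → Fin 3 → ℝ} {r : ℝ} {A A₁ A₂ B B₁ B₂ X X₁ X₂ Y Y₁ Y₂ Z Z₁ Z₂ : ℝ → ℝ}
  (D : FrameData f r A A₁ A₂ B B₁ B₂ X X₁ X₂ Y Y₁ Y₂ Z Z₁ Z₂)
include D

theorem hasDerivAt_velocity (t : ℝ) :
    HasDerivAt (deriv (curve f r)) ![-(r * Real.cos t), A₁ t, B₁ t] t := by
  rw [funext D.velocity, hasDerivAt_pi]
  intro i
  fin_cases i
  · exact ((Real.hasDerivAt_sin t).const_mul r).neg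
  · exact D.A' t
  · exact D.B' t

theorem hasDerivAt_cross (t : ℝ) : HasDerivAt (crossVec f r) ![X₁ t, Y₁ t, Z₁ t] t := by
  rw [funext D.cross, hasDerivAt_pi]
  intro i
  fin_cases i
  · exact D.X' t
  · exact D.Y' t
  · exact D.Z' t

theorem velocity_sq (t : ℝ) : deriv (curve f r) t ⬝ᵥ deriv (curve f r) t =
    (r * Real.sin t) ^ 2 + A t ^ 2 + B t ^ 2 := by
  rw [D.velocity]
  simp [dotProduct, Fin.sum_univ_three]
  ring

theorem cross_sq (t : ℝ) : crossVec f r t ⬝ᵥ crossVec f r t = X t ^ 2 + Y t ^ 2 + Z t ^ 2 := by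
  rw [D.cross]
  simp [dotProduct, Fin.sum_univ_three]
  ring

theorem len_cross (t : ℝ) : len (crossVec f r t) = √(X t ^ 2 + Y t ^ 2 + Z t ^ 2) := by
  rw [len, D.cross_sq]

theorem velocity_sq_ne (hr : r ≠ 0) {t : ℝ} (ht : Real.sin t ≠ 0) :
    deriv (curve f r) t ⬝ᵥ deriv (curve f r) t ≠ 0 := by
  rw [D.velocity_sq]
  positivity

theorem kappa1_coord (hr : r ≠ 0) {t : ℝ} (ht : Real.sin t ≠ 0) :
    kappa1 f r t = -(-(r * Real.cos t) * (A t * Z t - B t * Y t)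
        + A₁ t * (B t * X t + r * Real.sin t * Z t)
        + B₁ t * (-(r * Real.sin t) * Y t - A t * X t)) /
      (((r * Real.sin t) ^ 2 + A t ^ 2 + B t ^ 2) * √(X t ^ 2 + Y t ^ 2 + Z t ^ 2)) := by
  rw [kappa1_eq (D.hasDerivAt_velocity t) (D.velocity_sq_ne hr ht), D.velocity_sq, D.len_cross,
    D.velocity, D.cross]
  simp [dotProduct, Fin.sum_univ_three, cross_apply]

theorem kappaHat2_coord (hr : r ≠ 0) {t : ℝ} (ht : Real.sin t ≠ 0) :
    kappaHat2 f r t = (-(r * Real.cos t) * X t + A₁ t * Y t + B₁ t * Z t) /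
      √(X t ^ 2 + Y t ^ 2 + Z t ^ 2) := by
  have ho : deriv (curve f r) t ⬝ᵥ crossVec f r t = 0 := by
    rw [D.velocity, D.cross, ← D.orth t]
    simp [dotProduct, Fin.sum_univ_three]
  rw [kappaHat2,
    kappa2_eq (D.hasDerivAt_velocity t) (D.velocity_sq_ne hr ht) ho, D.len_cross, D.cross]
  simp [dotProduct, Fin.sum_univ_three]

theorem kappaHat3_coord (hr : r ≠ 0) {t : ℝ} (ht : Real.sin t ≠ 0)
    (hM : X t ^ 2 + Y t ^ 2 + Z t ^ 2 ≠ 0) :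
    kappaHat3 f r t = -((A t * Z₁ t - B t * Y₁ t) * X t
        + (B t * X₁ t + r * Real.sin t * Z₁ t) * Y t
        + (-(r * Real.sin t) * Y₁ t - A t * X₁ t) * Z t) /
      (X t ^ 2 + Y t ^ 2 + Z t ^ 2) := by
  rw [← D.cross_sq] at hM
  rw [kappaHat3, kappa3_eq (D.hasDerivAt_velocity t) (D.hasDerivAt_cross t)
    (D.velocity_sq_ne hr ht) hM, D.cross_sq, D.cross, D.velocity]
  simp [dotProduct, Fin.sum_univ_three, cross_apply]

theorem hasDerivAt_normSq (t : ℝ) : HasDerivAt (fun t => X t ^ 2 + Y t ^ 2 + Z t ^ 2)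
    (2 * (X t * X₁ t + Y t * Y₁ t + Z t * Z₁ t)) t :=
  ((((D.X' t).pow 2).add ((D.Y' t).pow 2)).add ((D.Z' t).pow 2)).congr_deriv (by
    simp; ring)

/-- The coordinate formulas hold only under these two conditions; to be differentiated at `t` they
must hold on a neighbourhood. -/
theorem eventually_ne {t : ℝ} (ht : Real.sin t ≠ 0) (hM : X t ^ 2 + Y t ^ 2 + Z t ^ 2 ≠ 0) :
    ∀ᶠ s in 𝓝 t, Real.sin s ≠ 0 ∧ X s ^ 2 + Y s ^ 2 + Z s ^ 2 ≠ 0 :=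
  (Real.continuous_sin.continuousAt.eventually_ne ht).and
    ((D.hasDerivAt_normSq t).continuousAt.eventually_ne hM)

theorem deriv_kappaHat2 (hr : r ≠ 0) {t : ℝ} (ht : Real.sin t ≠ 0)
    (hM : X t ^ 2 + Y t ^ 2 + Z t ^ 2 ≠ 0) :
    deriv (kappaHat2 f r) t =
      (r * Real.sin t * X t + A₂ t * Y t + B₂ t * Z t
        - (r * Real.cos t) * X₁ t + A₁ t * Y₁ t + B₁ t * Z₁ t) / √(X t ^ 2 + Y t ^ 2 + Z t ^ 2)
      - (-(r * Real.cos t) * X t + A₁ t * Y t + B₁ t * Z t)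
        * (X t * X₁ t + Y t * Y₁ t + Z t * Z₁ t) / √(X t ^ 2 + Y t ^ 2 + Z t ^ 2) ^ 3 := by
  have he : kappaHat2 f r =ᶠ[𝓝 t] fun t =>
      (-(r * Real.cos t) * X t + A₁ t * Y t + B₁ t * Z t) / √(X t ^ 2 + Y t ^ 2 + Z t ^ 2) := by
    filter_upwards [D.eventually_ne ht hM] with s hs using D.kappaHat2_coord hr hs.1
  have hne : √(X t ^ 2 + Y t ^ 2 + Z t ^ 2) ≠ 0 := by
    rw [Real.sqrt_ne_zero (by positivity)]; exact hM
  have hn := ((((((Real.hasDerivAt_cos t).const_mul r).neg).mul (D.X' t)).add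
    ((D.A'' t).mul (D.Y' t))).add ((D.B'' t).mul (D.Z' t)))
  refine he.deriv_eq.trans ((hn.div ((D.hasDerivAt_normSq t).sqrt hM) hne).deriv.trans ?_)
  simp only [Pi.add_apply, Pi.mul_apply, Pi.neg_apply]
  field_simp
  ring

theorem deriv_kappaHat3 (hr : r ≠ 0) {t : ℝ} (ht : Real.sin t ≠ 0)
    (hM : X t ^ 2 + Y t ^ 2 + Z t ^ 2 ≠ 0) :
    deriv (kappaHat3 f r) t =
      -((A₁ t * Z₁ t - B₁ t * Y₁ t) * X t
        + (B₁ t * X₁ t + r * Real.cos t * Z₁ t) * Y t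
        + (-(r * Real.cos t) * Y₁ t - A₁ t * X₁ t) * Z t
        + (A t * Z₂ t - B t * Y₂ t) * X t
        + (B t * X₂ t + r * Real.sin t * Z₂ t) * Y t
        + (-(r * Real.sin t) * Y₂ t - A t * X₂ t) * Z t) / (X t ^ 2 + Y t ^ 2 + Z t ^ 2)
      + 2 * ((A t * Z₁ t - B t * Y₁ t) * X t
        + (B t * X₁ t + r * Real.sin t * Z₁ t) * Y t
        + (-(r * Real.sin t) * Y₁ t - A t * X₁ t) * Z t)
        * (X t * X₁ t + Y t * Y₁ t + Z t * Z₁ t) / (X t ^ 2 + Y t ^ 2 + Z t ^ 2) ^ 2 := by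
  have he : kappaHat3 f r =ᶠ[𝓝 t] fun t =>
      -((A t * Z₁ t - B t * Y₁ t) * X t
        + (B t * X₁ t + r * Real.sin t * Z₁ t) * Y t
        + (-(r * Real.sin t) * Y₁ t - A t * X₁ t) * Z t) /
      (X t ^ 2 + Y t ^ 2 + Z t ^ 2) := by
    filter_upwards [D.eventually_ne ht hM] with s hs using D.kappaHat3_coord hr hs.1 hs.2
  have hs := (Real.hasDerivAt_sin t).const_mul r
  have hn := ((((((D.A' t).mul (D.Z'' t)).sub ((D.B' t).mul (D.Y'' t))).mul (D.X' t)).add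
    ((((D.B' t).mul (D.X'' t)).add (hs.mul (D.Z'' t))).mul (D.Y' t))).add
    (((hs.neg.mul (D.Y'' t)).sub ((D.A' t).mul (D.X'' t))).mul (D.Z' t))).neg
  refine he.deriv_eq.trans ((hn.div (D.hasDerivAt_normSq t) hM).deriv.trans ?_)
  simp only [Pi.add_apply, Pi.mul_apply, Pi.neg_apply, Pi.sub_apply]
  field_simp
  ring

end FrameData

/-! ### Asymptotics for small radii -/

/-- `χ(r) = c + O(r)` as `r → 0+`. -/
def Near (χ : ℝ → ℝ) (c : ℝ) : Prop := (fun r => χ r - c) =O[𝓝[>] 0] fun r : ℝ => r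

namespace Near

variable {χ ψ : ℝ → ℝ} {c d : ℝ}

theorem tendsto (h : Near χ c) : Tendsto χ (𝓝[>] 0) (𝓝 c) := by
  have h0 : Tendsto (fun r : ℝ => r) (𝓝[>] 0) (𝓝 0) := tendsto_nhdsWithin_of_tendsto_nhds tendsto_id
  simpa using (h.trans_tendsto h0).add_const c

theorem id : Near (fun r => r) 0 := by
  simpa [Near] using isBigO_refl (fun r : ℝ => r) (𝓝[>] 0)

theorem const (c : ℝ) : Near (fun _ => c) c := by
  simpa [Near] using isBigO_zero _ _

/-- Differentiability at the limit alone gives `F(χ) - F(c) = O(χ - c) = O(r)`; the two-variable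
version gives the arithmetic rules. -/
theorem map {F : ℝ → ℝ} (hF : DifferentiableAt ℝ F c) (h : Near χ c) :
    Near (fun r => F (χ r)) (F c) :=
  (hF.isBigO_sub.comp_tendsto h.tendsto).trans h

theorem map₂ {F : ℝ × ℝ → ℝ} (hF : DifferentiableAt ℝ F (c, d)) (h : Near χ c) (h' : Near ψ d) :
    Near (fun r => F (χ r, ψ r)) (F (c, d)) :=
  (hF.isBigO_sub.comp_tendsto (h.tendsto.prodMk_nhds h'.tendsto)).trans (h.prod_left h')

theorem add (h : Near χ c) (h' : Near ψ d) : Near (fun r => χ r + ψ r) (c + d) :=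
  map₂ (F := fun p => p.1 + p.2) (by fun_prop) h h'

theorem sub (h : Near χ c) (h' : Near ψ d) : Near (fun r => χ r - ψ r) (c - d) :=
  map₂ (F := fun p => p.1 - p.2) (by fun_prop) h h'

theorem mul (h : Near χ c) (h' : Near ψ d) : Near (fun r => χ r * ψ r) (c * d) :=
  map₂ (F := fun p => p.1 * p.2) (by fun_prop) h h'

theorem div (h : Near χ c) (h' : Near ψ d) (hd : d ≠ 0) : Near (fun r => χ r / ψ r) (c / d) :=
  map₂ (F := fun p => p.1 / p.2) (by fun_prop (disch := simpa)) h h'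

theorem neg (h : Near χ c) : Near (fun r => -χ r) (-c) :=
  map (F := fun t => -t) (by fun_prop) h

theorem pow (h : Near χ c) (n : ℕ) : Near (fun r => χ r ^ n) (c ^ n) :=
  map (F := fun t => t ^ n) (by fun_prop) h

theorem sqrt (h : Near χ c) (hc : c ≠ 0) : Near (fun r => √(χ r)) √c :=
  map (F := fun t => √t) (by fun_prop (disch := simpa)) h

end Near

theorem IsFirstTerm.of_near {x : ℝ → ℝ → ℝ} {F x₀ : ℝ → ℝ} {i : ℕ}
    (hx₀ : ∀ θ ∈ Ioo 0 Real.pi, x₀ θ ≠ 0) (hF : ∃ θ ∈ Ioo 0 Real.pi, F θ ≠ 0)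
    (h : ∀ θ ∈ Ioo 0 Real.pi, ∃ χ : ℝ → ℝ, Near χ (F θ * x₀ θ) ∧
      ∀ᶠ r in 𝓝[>] 0, x r θ = r ^ i * χ r) : IsFirstTerm x F := by
  refine ⟨i, x₀, hx₀, hF, fun θ hθ => ?_⟩
  obtain ⟨χ, hχ, he⟩ := h θ hθ
  refine ((isBigO_refl (fun r : ℝ => r ^ i) (𝓝[>] 0)).mul hχ).congr' ?_ ?_
  · filter_upwards [he] with r hr
    rw [hr]; ring
  · exact Eventually.of_forall fun r => (pow_succ r i).symm

/-! ### Rescaled components and their limits as `r → 0` -/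

/-- Values at one angle of the rescaled coordinates of the velocity and the normal, and of their
derivatives. -/
structure Jet where
  (g g₁ g₂ h h₁ h₂ x x₁ x₂ y y₁ y₂ z z₁ z₂ : ℝ)

namespace Jet

/-- The rescaled length of the normal. -/
noncomputable def norm (r : ℝ) (j : Jet) : ℝ := √(r ^ 2 * j.x ^ 2 + j.y ^ 2 + j.z ^ 2)

/-- `T' ⬝ C`, rescaled, for the velocity `T` and the normal `C`. -/
def second (c : ℝ) (j : Jet) : ℝ := -c * j.x + j.g₁ * j.y + j.h₁ * j.z

/-- The derivative of `second`. -/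
def second' (s c : ℝ) (j : Jet) : ℝ :=
  s * j.x + j.g₂ * j.y + j.h₂ * j.z - c * j.x₁ + j.g₁ * j.y₁ + j.h₁ * j.z₁

/-- `C ⬝ C'`, rescaled. -/
def nu (r : ℝ) (j : Jet) : ℝ := r ^ 2 * (j.x * j.x₁) + j.y * j.y₁ + j.z * j.z₁

/-- `(T × C') ⬝ C`, rescaled. -/
def twist (s r : ℝ) (j : Jet) : ℝ :=
  r ^ 2 * ((j.g * j.z₁ - j.h * j.y₁) * j.x) + (r ^ 2 * (j.h * j.x₁) + s * j.z₁) * j.y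
    + (-s * j.y₁ - r ^ 2 * (j.g * j.x₁)) * j.z

/-- The derivative of `twist`. -/
def twist' (s c r : ℝ) (j : Jet) : ℝ :=
  r ^ 2 * ((j.g₁ * j.z₁ - j.h₁ * j.y₁) * j.x) + (r ^ 2 * (j.h₁ * j.x₁) + c * j.z₁) * j.y
    + (-c * j.y₁ - r ^ 2 * (j.g₁ * j.x₁)) * j.z
    + (r ^ 2 * ((j.g * j.z₂ - j.h * j.y₂) * j.x) + (r ^ 2 * (j.h * j.x₂) + s * j.z₂) * j.y
    + (-s * j.y₂ - r ^ 2 * (j.g * j.x₂)) * j.z)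

/-- `T' ⬝ (T × C)`, rescaled. -/
def geod (s c r : ℝ) (j : Jet) : ℝ :=
  -c * (j.g * j.z - j.h * j.y) + j.g₁ * (r ^ 2 * (j.h * j.x) + s * j.z)
    + j.h₁ * (-s * j.y - r ^ 2 * (j.g * j.x))

/-- `κ₁ / r`. -/
noncomputable def k1 (s c r : ℝ) (j : Jet) : ℝ :=
  -geod s c r j / ((s ^ 2 + r ^ 2 * (j.g ^ 2 + j.h ^ 2)) * norm r j)

/-- `κ̂₂ / r²`. -/
noncomputable def k2 (c r : ℝ) (j : Jet) : ℝ := second c j / norm r j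

/-- `κ̂₃ / r`. -/
noncomputable def k3 (s r : ℝ) (j : Jet) : ℝ := -twist s r j / norm r j ^ 2

/-- `κ̂₂' / r²`. -/
noncomputable def k2' (s c r : ℝ) (j : Jet) : ℝ :=
  second' s c j / norm r j - second c j * nu r j / norm r j ^ 3

/-- `κ̂₃' / r`. -/
noncomputable def k3' (s c r : ℝ) (j : Jet) : ℝ :=
  -twist' s c r j / norm r j ^ 2 + 2 * twist s r j * nu r j / norm r j ^ 4

/-- `δ / r³`. -/
noncomputable def del (s c r : ℝ) (j : Jet) : ℝ :=
  k1 s c r j * (r ^ 2 * k2 c r j ^ 2 + k3 s r j ^ 2) - k2' s c r j * k3 s r j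
    + k2 c r j * k3' s c r j

/-- All components of `J` are those of `j` up to `O(r)`. -/
structure NearJet (J : ℝ → Jet) (j : Jet) : Prop where
  g : Near (fun r => (J r).g) j.g
  g₁ : Near (fun r => (J r).g₁) j.g₁
  g₂ : Near (fun r => (J r).g₂) j.g₂
  h : Near (fun r => (J r).h) j.h
  h₁ : Near (fun r => (J r).h₁) j.h₁
  h₂ : Near (fun r => (J r).h₂) j.h₂
  x : Near (fun r => (J r).x) j.x
  x₁ : Near (fun r => (J r).x₁) j.x₁
  x₂ : Near (fun r => (J r).x₂) j.x₂
  y : Near (fun r => (J r).y) j.y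
  y₁ : Near (fun r => (J r).y₁) j.y₁
  y₂ : Near (fun r => (J r).y₂) j.y₂
  z : Near (fun r => (J r).z) j.z
  z₁ : Near (fun r => (J r).z₁) j.z₁
  z₂ : Near (fun r => (J r).z₂) j.z₂

variable {J : ℝ → Jet} {j : Jet}

theorem norm_zero_pos (hj : 0 < j.y ^ 2 + j.z ^ 2) : 0 < norm 0 j := by
  rw [norm]
  exact Real.sqrt_pos.2 (by simpa using hj)

namespace NearJet

theorem norm (H : NearJet J j) (hj : 0 < j.y ^ 2 + j.z ^ 2) :
    Near (fun r => norm r (J r)) (norm 0 j) :=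
  ((((Near.id.pow 2).mul (H.x.pow 2)).add (H.y.pow 2)).add (H.z.pow 2)).sqrt (by
    simpa using hj.ne')

theorem second (c : ℝ) (H : NearJet J j) : Near (fun r => second c (J r)) (second c j) :=
  (((Near.const (-c)).mul H.x).add (H.g₁.mul H.y)).add (H.h₁.mul H.z)

theorem second' (s c : ℝ) (H : NearJet J j) : Near (fun r => second' s c (J r)) (second' s c j) :=
  ((((((Near.const s).mul H.x).add (H.g₂.mul H.y)).add (H.h₂.mul H.z)).sub
    ((Near.const c).mul H.x₁)).add (H.g₁.mul H.y₁)).add (H.h₁.mul H.z₁)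

theorem nu (H : NearJet J j) : Near (fun r => nu r (J r)) (nu 0 j) :=
  (((Near.id.pow 2).mul (H.x.mul H.x₁)).add (H.y.mul H.y₁)).add (H.z.mul H.z₁)

/-- Serves `twist` and both halves of `twist'`. Differentiating `(T × C') ⬝ C` gives `(T' × C') ⬝ C
+ (T × C'') ⬝ C`, since `(T × C') ⬝ C' = 0`, and each summand has the shape of `twist`. -/
theorem twist_aux {g h x x₁ y y₁ z z₁ : ℝ → ℝ} {g₀ h₀ x₀ x₁₀ y₀ y₁₀ z₀ z₁₀ : ℝ} (s : ℝ)
    (hg : Near g g₀) (hh : Near h h₀) (hx : Near x x₀) (hx₁ : Near x₁ x₁₀) (hy : Near y y₀)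
    (hy₁ : Near y₁ y₁₀) (hz : Near z z₀) (hz₁ : Near z₁ z₁₀) :
    Near (fun r => r ^ 2 * ((g r * z₁ r - h r * y₁ r) * x r)
        + (r ^ 2 * (h r * x₁ r) + s * z₁ r) * y r + (-s * y₁ r - r ^ 2 * (g r * x₁ r)) * z r)
      (0 ^ 2 * ((g₀ * z₁₀ - h₀ * y₁₀) * x₀) + (0 ^ 2 * (h₀ * x₁₀) + s * z₁₀) * y₀
        + (-s * y₁₀ - 0 ^ 2 * (g₀ * x₁₀)) * z₀) :=
  (((Near.id.pow 2).mul (((hg.mul hz₁).sub (hh.mul hy₁)).mul hx)).add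
    ((((Near.id.pow 2).mul (hh.mul hx₁)).add ((Near.const s).mul hz₁)).mul hy)).add
    ((((Near.const (-s)).mul hy₁).sub ((Near.id.pow 2).mul (hg.mul hx₁))).mul hz)

theorem twist (s : ℝ) (H : NearJet J j) : Near (fun r => twist s r (J r)) (twist s 0 j) :=
  twist_aux s H.g H.h H.x H.x₁ H.y H.y₁ H.z H.z₁

theorem twist' (s c : ℝ) (H : NearJet J j) :
    Near (fun r => twist' s c r (J r)) (twist' s c 0 j) :=
  (twist_aux c H.g₁ H.h₁ H.x H.x₁ H.y H.y₁ H.z H.z₁).add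
    (twist_aux s H.g H.h H.x H.x₂ H.y H.y₂ H.z H.z₂)

theorem geod (s c : ℝ) (H : NearJet J j) : Near (fun r => geod s c r (J r)) (geod s c 0 j) :=
  (((Near.const (-c)).mul ((H.g.mul H.z).sub (H.h.mul H.y))).add
    (H.g₁.mul (((Near.id.pow 2).mul (H.h.mul H.x)).add ((Near.const s).mul H.z)))).add
    (H.h₁.mul (((Near.const (-s)).mul H.y).sub ((Near.id.pow 2).mul (H.g.mul H.x))))

variable {s : ℝ} (c : ℝ)

theorem k1 (H : NearJet J j) (hj : 0 < j.y ^ 2 + j.z ^ 2) (hs : s ≠ 0) :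
    Near (fun r => k1 s c r (J r)) (k1 s c 0 j) :=
  (H.geod s c).neg.div (((Near.const (s ^ 2)).add ((Near.id.pow 2).mul
    ((H.g.pow 2).add (H.h.pow 2)))).mul (H.norm hj)) (by
      simpa using ⟨hs, (norm_zero_pos hj).ne'⟩)

theorem k2 (H : NearJet J j) (hj : 0 < j.y ^ 2 + j.z ^ 2) :
    Near (fun r => k2 c r (J r)) (k2 c 0 j) :=
  (H.second c).div (H.norm hj) (norm_zero_pos hj).ne'

theorem k3 (s : ℝ) (H : NearJet J j) (hj : 0 < j.y ^ 2 + j.z ^ 2) :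
    Near (fun r => k3 s r (J r)) (k3 s 0 j) :=
  (H.twist s).neg.div ((H.norm hj).pow 2) (pow_ne_zero _ (norm_zero_pos hj).ne')

theorem k2' (s : ℝ) (H : NearJet J j) (hj : 0 < j.y ^ 2 + j.z ^ 2) :
    Near (fun r => k2' s c r (J r)) (k2' s c 0 j) :=
  ((H.second' s c).div (H.norm hj) (norm_zero_pos hj).ne').sub
    (((H.second c).mul H.nu).div ((H.norm hj).pow 3) (pow_ne_zero _ (norm_zero_pos hj).ne'))

theorem k3' (s : ℝ) (H : NearJet J j) (hj : 0 < j.y ^ 2 + j.z ^ 2) :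
    Near (fun r => k3' s c r (J r)) (k3' s c 0 j) :=
  ((H.twist' s c).neg.div ((H.norm hj).pow 2) (pow_ne_zero _ (norm_zero_pos hj).ne')).add
    ((((Near.const 2).mul (H.twist s)).mul H.nu).div ((H.norm hj).pow 4)
      (pow_ne_zero _ (norm_zero_pos hj).ne'))

theorem del (H : NearJet J j) (hj : 0 < j.y ^ 2 + j.z ^ 2) (hs : s ≠ 0) :
    Near (fun r => del s c r (J r)) (del s c 0 j) :=
  (((H.k1 c hj hs).mul (((Near.id.pow 2).mul ((H.k2 c hj).pow 2)).add ((H.k3 s hj).pow 2))).sub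
    ((H.k2' c s hj).mul (H.k3 s hj))).add ((H.k2 c hj).mul (H.k3' c s hj))

end NearJet

end Jet

/-- The coordinates at the angle `t` are obtained from the jet `j` by rescaling. -/
structure FrameData.HasJet {f : ℝ × ℝ → Fin 3 → ℝ} {r : ℝ}
    {A A₁ A₂ B B₁ B₂ X X₁ X₂ Y Y₁ Y₂ Z Z₁ Z₂ : ℝ → ℝ}
    (_ : FrameData f r A A₁ A₂ B B₁ B₂ X X₁ X₂ Y Y₁ Y₂ Z Z₁ Z₂) (t : ℝ) (j : Jet) : Prop where
  A : A t = r ^ 2 * j.g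
  A₁ : A₁ t = r ^ 2 * j.g₁
  A₂ : A₂ t = r ^ 2 * j.g₂
  B : B t = r ^ 2 * j.h
  B₁ : B₁ t = r ^ 2 * j.h₁
  B₂ : B₂ t = r ^ 2 * j.h₂
  X : X t = r ^ 2 * j.x
  X₁ : X₁ t = r ^ 2 * j.x₁
  X₂ : X₂ t = r ^ 2 * j.x₂
  Y : Y t = r * j.y
  Y₁ : Y₁ t = r * j.y₁
  Y₂ : Y₂ t = r * j.y₂
  Z : Z t = r * j.z
  Z₁ : Z₁ t = r * j.z₁
  Z₂ : Z₂ t = r * j.z₂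

namespace FrameData.HasJet

variable {f : ℝ × ℝ → Fin 3 → ℝ} {r t : ℝ} {A A₁ A₂ B B₁ B₂ X X₁ X₂ Y Y₁ Y₂ Z Z₁ Z₂ : ℝ → ℝ}
  {D : FrameData f r A A₁ A₂ B B₁ B₂ X X₁ X₂ Y Y₁ Y₂ Z Z₁ Z₂} {j : Jet}

theorem sqrt_eq (hJ : D.HasJet t j) (hr : 0 < r) :
    √(X t ^ 2 + Y t ^ 2 + Z t ^ 2) = r * j.norm r := by
  rw [hJ.X, hJ.Y, hJ.Z, show (r ^ 2 * j.x) ^ 2 + (r * j.y) ^ 2 + (r * j.z) ^ 2 =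
    r ^ 2 * (r ^ 2 * j.x ^ 2 + j.y ^ 2 + j.z ^ 2) by ring, Real.sqrt_mul (by positivity),
    Real.sqrt_sq hr.le, Jet.norm]

theorem normSq_eq (hJ : D.HasJet t j) (hr : 0 < r) :
    X t ^ 2 + Y t ^ 2 + Z t ^ 2 = (r * j.norm r) ^ 2 := by
  rw [← hJ.sqrt_eq hr, Real.sq_sqrt (by positivity)]

variable (hJ : D.HasJet t j) (hr : 0 < r) (ht : Real.sin t ≠ 0) (hj : j.norm r ≠ 0)
include hJ hr ht

theorem kappaHat2_eq : kappaHat2 f r t = r ^ 2 * j.k2 (Real.cos t) r := by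
  rw [D.kappaHat2_coord hr.ne' ht, hJ.sqrt_eq hr, Jet.k2, Jet.second, hJ.X, hJ.Y, hJ.Z, hJ.A₁, hJ.B₁]
  -- If the normal vanishes, both sides are quotients by zero, hence zero.
  rcases eq_or_ne (j.norm r) 0 with h | h
  · simp [h]
  · field_simp

include hj

/-- The orders are `κ₁ ~ r`, `κ̂₂, κ̂₂' ~ r²` and `κ̂₃, κ̂₃' ~ r`. Every term of `δ` thus carries
`r³`, except `κ₁ κ̂₂²`, which carries `r⁵` and disappears in the limit. -/
theorem delta_eq : delta f r t = r ^ 3 * j.del (Real.sin t) (Real.cos t) r := by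
  have hM : X t ^ 2 + Y t ^ 2 + Z t ^ 2 ≠ 0 := by
    rw [hJ.normSq_eq hr]
    positivity
  have e1 : kappa1 f r t = r * j.k1 (Real.sin t) (Real.cos t) r := by
    have : Real.sin t ^ 2 + r ^ 2 * (j.g ^ 2 + j.h ^ 2) ≠ 0 := by positivity
    rw [D.kappa1_coord hr.ne' ht, hJ.sqrt_eq hr, Jet.k1, Jet.geod, hJ.X, hJ.Y, hJ.Z, hJ.A, hJ.B, hJ.A₁,
      hJ.B₁, show (r * Real.sin t) ^ 2 + (r ^ 2 * j.g) ^ 2 + (r ^ 2 * j.h) ^ 2 =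
        r ^ 2 * (Real.sin t ^ 2 + r ^ 2 * (j.g ^ 2 + j.h ^ 2)) by ring]
    field_simp
  have e3 : kappaHat3 f r t = r * j.k3 (Real.sin t) r := by
    rw [D.kappaHat3_coord hr.ne' ht hM, hJ.normSq_eq hr, Jet.k3, Jet.twist, hJ.X, hJ.Y, hJ.Z, hJ.A, hJ.B,
      hJ.X₁, hJ.Y₁, hJ.Z₁]
    field_simp
  have e2' : deriv (kappaHat2 f r) t = r ^ 2 * j.k2' (Real.sin t) (Real.cos t) r := by
    rw [D.deriv_kappaHat2 hr.ne' ht hM, hJ.sqrt_eq hr, Jet.k2', Jet.second, Jet.second', Jet.nu,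
      hJ.X, hJ.Y, hJ.Z, hJ.A₁, hJ.B₁, hJ.A₂, hJ.B₂, hJ.X₁, hJ.Y₁, hJ.Z₁]
    field_simp
  have e3' : deriv (kappaHat3 f r) t = r * j.k3' (Real.sin t) (Real.cos t) r := by
    rw [D.deriv_kappaHat3 hr.ne' ht hM, hJ.normSq_eq hr, Jet.k3', Jet.twist, Jet.twist', Jet.nu,
      hJ.X, hJ.Y, hJ.Z, hJ.A, hJ.B, hJ.A₁, hJ.B₁, hJ.X₁, hJ.Y₁, hJ.Z₁, hJ.X₂, hJ.Y₂, hJ.Z₂]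
    field_simp
    ring
  rw [delta, e1, e3, e2', e3', hJ.kappaHat2_eq hr ht, Jet.del]
  ring

end FrameData.HasJet

/-! ### The jet of a Whitney umbrella in normal form -/

/-- Since `k ≥ 3`, the remainders have order at least 4, and all monomials of degree at least 3 are
absorbed into the error. -/
theorem IsNormalForm.exists_isQuad {f : ℝ × ℝ → Fin 3 → ℝ} {k : ℕ} {b : ℕ → ℝ} {a : ℕ → ℕ → ℝ}
    (h : IsNormalForm f k b a) : ∃ U : Set (ℝ × ℝ), IsOpen U ∧ (0 : ℝ × ℝ) ∈ U ∧
      ContDiffOn ℝ ∞ f U ∧ (∀ p ∈ U, f p 0 = p.1) ∧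
      IsQuad U (fun p => f p 1) 0 1 0 ∧
      IsQuad U (fun p => f p 2) (a 2 0 / 2) (a 1 1) (a 0 2 / 2) := by
  obtain ⟨U, hU, h0, hf, hf0⟩ := h.smooth
  have hk := h.three_le
  have hx := OrdOn.fst (U := U)
  have hy := OrdOn.snd (U := U)
  refine ⟨U, hU, h0, hf, hf0, ?_, ?_⟩
  · have h1 : OrdOn U 3 _ := OrdOn.mono ⟨((contDiffOn_pi.1 hf 1).sub
      (ContDiff.contDiffOn (by fun_prop))), h.second⟩ (by omega)
    have h2 : OrdOn U 3 fun p => ∑ i ∈ Finset.Icc 3 k, b i / (i ! : ℝ) * p.2 ^ i :=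
      OrdOn.sum hU h0 _ fun i hi =>
        ((hy.pow hU h0 i).const_mul hU h0 _).mono (Finset.mem_Icc.1 hi).1
    exact (h1.add hU h0 h2).congr hU h0 fun p _ => by ring
  · have h1 : OrdOn U 3 _ := OrdOn.mono ⟨((contDiffOn_pi.1 hf 2).sub
      (ContDiff.contDiffOn (by fun_prop))), h.third⟩ (by omega)
    have h2 : OrdOn U 3 fun p => ∑ m ∈ (Finset.Icc 2 k).erase 2, ∑ i ∈ Finset.range (m + 1),
        a i (m - i) / ((i ! : ℝ) * ((m - i)! : ℝ)) * p.1 ^ i * p.2 ^ (m - i) := by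
      refine OrdOn.sum hU h0 _ fun m hm => OrdOn.sum hU h0 _ fun i hi => ?_
      rw [Finset.mem_erase, Finset.mem_Icc] at hm
      rw [Finset.mem_range] at hi
      exact (((hx.pow hU h0 i).const_mul hU h0 _).mul hU h0 (hy.pow hU h0 (m - i))).mono (by omega)
    refine (h1.add hU h0 h2).congr hU h0 fun p _ => ?_
    simp only
    rw [← Finset.add_sum_erase (Finset.Icc 2 k) _ (Finset.mem_Icc.2 ⟨le_rfl, by omega⟩)]
    simp [Finset.sum_range_succ, Nat.factorial]
    ring

theorem IsLin.near {U : Set (ℝ × ℝ)} {H : ℝ × ℝ → ℝ} {a b v θ : ℝ} (hU : IsOpen U)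
    (h0 : (0 : ℝ × ℝ) ∈ U) (h : IsLin U H a b) (hv : v = a * Real.cos θ + b * Real.sin θ) :
    Near (fun r => H (polar r θ) / r) v :=
  hv ▸ h.isBigO hU h0 θ

theorem IsQuad.near {U : Set (ℝ × ℝ)} {H : ℝ × ℝ → ℝ} {a b c v θ : ℝ} (hU : IsOpen U)
    (h0 : (0 : ℝ × ℝ) ∈ U) (h : IsQuad U H a b c)
    (hv : v = a * Real.cos θ ^ 2 + b * (Real.cos θ * Real.sin θ) + c * Real.sin θ ^ 2) :
    Near (fun r => H (polar r θ) / r ^ 2) v :=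
  hv ▸ h.isBigO hU h0 θ

/-- The components of `f_u × f_v`, for `f` with first component `u`. -/
noncomputable def crossComp (f : ℝ × ℝ → Fin 3 → ℝ) (p : ℝ × ℝ) : Fin 3 → ℝ :=
  ![fderiv ℝ (fun p => f p 1) p (1, 0) * fderiv ℝ (fun p => f p 2) p (0, 1)
      - fderiv ℝ (fun p => f p 2) p (1, 0) * fderiv ℝ (fun p => f p 1) p (0, 1),
    -fderiv ℝ (fun p => f p 2) p (0, 1), fderiv ℝ (fun p => f p 1) p (0, 1)]

/-- The jet at radius zero. -/
def limitJet (a b w s c : ℝ) : Jet where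
  g := c ^ 2 - s ^ 2
  g₁ := -4 * (c * s)
  g₂ := -4 * (c ^ 2 - s ^ 2)
  h := b * (c ^ 2 - s ^ 2) + (w - a) * (c * s)
  h₁ := (w - a) * (c ^ 2 - s ^ 2) - 4 * b * (c * s)
  h₂ := -4 * (b * (c ^ 2 - s ^ 2) + (w - a) * (c * s))
  x := w * s ^ 2 - a * c ^ 2
  x₁ := 2 * (w + a) * (c * s)
  x₂ := 2 * (w + a) * (c ^ 2 - s ^ 2)
  y := -(b * c + w * s)
  y₁ := b * s - w * c
  y₂ := b * c + w * s
  z := c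
  z₁ := -s
  z₂ := -c

/-- The jet of `f` at radius `r` and angle `θ`. -/
noncomputable def jetAt (f : ℝ × ℝ → Fin 3 → ℝ) (θ r : ℝ) : Jet where
  g := rot (fun p => f p 1) (polar r θ) / r ^ 2
  g₁ := rot (rot fun p => f p 1) (polar r θ) / r ^ 2
  g₂ := rot (rot (rot fun p => f p 1)) (polar r θ) / r ^ 2
  h := rot (fun p => f p 2) (polar r θ) / r ^ 2
  h₁ := rot (rot fun p => f p 2) (polar r θ) / r ^ 2
  h₂ := rot (rot (rot fun p => f p 2)) (polar r θ) / r ^ 2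
  x := crossComp f (polar r θ) 0 / r ^ 2
  x₁ := rot (fun p => crossComp f p 0) (polar r θ) / r ^ 2
  x₂ := rot (rot fun p => crossComp f p 0) (polar r θ) / r ^ 2
  y := crossComp f (polar r θ) 1 / r
  y₁ := rot (fun p => crossComp f p 1) (polar r θ) / r
  y₂ := rot (rot fun p => crossComp f p 1) (polar r θ) / r
  z := crossComp f (polar r θ) 2 / r
  z₁ := rot (fun p => crossComp f p 2) (polar r θ) / r
  z₂ := rot (rot fun p => crossComp f p 2) (polar r θ) / r

section

variable {f : ℝ × ℝ → Fin 3 → ℝ} {U : Set (ℝ × ℝ)} {a b w : ℝ}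

theorem isQuad_crossComp (hU : IsOpen U) (h0 : (0 : ℝ × ℝ) ∈ U)
    (h1 : IsQuad U (fun p => f p 1) 0 1 0) (h2 : IsQuad U (fun p => f p 2) (a / 2) b (w / 2)) :
    IsQuad U (fun p => crossComp f p 0) (-a) 0 w := by
  have h := ((h1.fderiv_fst hU h0).mul hU h0 (h2.fderiv_snd hU h0)).sub hU h0
    ((h2.fderiv_fst hU h0).mul hU h0 (h1.fderiv_snd hU h0))
  exact OrdOn.congr h hU h0 fun p _ => by simp only [crossComp, Matrix.cons_val]; ring

theorem isLin_crossComp_one (hU : IsOpen U) (h0 : (0 : ℝ × ℝ) ∈ U)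
    (h2 : IsQuad U (fun p => f p 2) (a / 2) b (w / 2)) :
    IsLin U (fun p => crossComp f p 1) (-b) (-w) := by
  exact OrdOn.congr ((h2.fderiv_snd hU h0).neg hU h0) hU h0 fun p _ => by
    simp only [crossComp, Matrix.cons_val]; ring

theorem isLin_crossComp_two (hU : IsOpen U) (h0 : (0 : ℝ × ℝ) ∈ U)
    (h1 : IsQuad U (fun p => f p 1) 0 1 0) : IsLin U (fun p => crossComp f p 2) 1 0 := by
  exact OrdOn.congr (h1.fderiv_snd hU h0) hU h0 fun p _ => by
    simp only [crossComp, Matrix.cons_val]; ring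

theorem nearJet_jetAt (hU : IsOpen U) (h0 : (0 : ℝ × ℝ) ∈ U)
    (h1 : IsQuad U (fun p => f p 1) 0 1 0) (h2 : IsQuad U (fun p => f p 2) (a / 2) b (w / 2))
    (θ : ℝ) : Jet.NearJet (jetAt f θ) (limitJet a b w (Real.sin θ) (Real.cos θ)) := by
  have hx := isQuad_crossComp hU h0 h1 h2
  have hy := isLin_crossComp_one hU h0 h2
  have hz := isLin_crossComp_two hU h0 h1
  have h1' := h1.rot hU h0
  have h1'' := h1'.rot hU h0
  have h2' := h2.rot hU h0
  have h2'' := h2'.rot hU h0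
  constructor
  · exact h1'.near hU h0 (by simp only [limitJet]; ring)
  · exact h1''.near hU h0 (by simp only [limitJet]; ring)
  · exact (h1''.rot hU h0).near hU h0 (by simp only [limitJet]; ring)
  · exact h2'.near hU h0 (by simp only [limitJet]; ring)
  · exact h2''.near hU h0 (by simp only [limitJet]; ring)
  · exact (h2''.rot hU h0).near hU h0 (by simp only [limitJet]; ring)
  · exact hx.near hU h0 (by simp only [limitJet]; ring)
  · exact (hx.rot hU h0).near hU h0 (by simp only [limitJet]; ring)
  · exact ((hx.rot hU h0).rot hU h0).near hU h0 (by simp only [limitJet]; ring)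
  · exact hy.near hU h0 (by simp only [limitJet]; ring)
  · exact (hy.rot hU h0).near hU h0 (by simp only [limitJet]; ring)
  · exact ((hy.rot hU h0).rot hU h0).near hU h0 (by simp only [limitJet]; ring)
  · exact hz.near hU h0 (by simp only [limitJet]; ring)
  · exact (hz.rot hU h0).near hU h0 (by simp only [limitJet]; ring)
  · exact ((hz.rot hU h0).rot hU h0).near hU h0 (by simp only [limitJet]; ring)

theorem fderiv_apply_comp {p : ℝ × ℝ} (hf : DifferentiableAt ℝ f p) (v : ℝ × ℝ) (i : Fin 3) :
    fderiv ℝ f p v i = fderiv ℝ (fun q => f q i) p v := by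
  rw [((hasFDerivAt_pi'.1 hf.hasFDerivAt) i).fderiv]
  rfl

theorem fderiv_fst_comp (hU : IsOpen U) (hf0 : ∀ p ∈ U, f p 0 = p.1) {p : ℝ × ℝ} (hp : p ∈ U) :
    fderiv ℝ (fun q => f q 0) p = ContinuousLinearMap.fst ℝ ℝ ℝ := by
  have : (fun q => f q 0) =ᶠ[𝓝 p] fun q => q.1 := by
    filter_upwards [hU.mem_nhds hp] with q hq using hf0 q hq
  rw [this.fderiv_eq]
  exact fderiv_fst

theorem cross_eq_crossComp (hU : IsOpen U) (hf : ContDiffOn ℝ ∞ f U)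
    (hf0 : ∀ p ∈ U, f p 0 = p.1) {p : ℝ × ℝ} (hp : p ∈ U) :
    fderiv ℝ f p (1, 0) ⨯₃ fderiv ℝ f p (0, 1) = crossComp f p := by
  have hd : DifferentiableAt ℝ f p :=
    (hf.contDiffAt (hU.mem_nhds hp)).differentiableAt (by simp)
  simp only [cross_apply, crossComp, fderiv_apply_comp hd, fderiv_fst_comp hU hf0 hp]
  simp

theorem frameData (hU : IsOpen U) (h0 : (0 : ℝ × ℝ) ∈ U) (hf : ContDiffOn ℝ ∞ f U)
    (hf0 : ∀ p ∈ U, f p 0 = p.1)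
    (h1 : IsQuad U (fun p => f p 1) 0 1 0) (h2 : IsQuad U (fun p => f p 2) (a / 2) b (w / 2))
    {r : ℝ} (hr : ∀ t, polar r t ∈ U) :
    FrameData f r (fun t => rot (fun p => f p 1) (polar r t))
      (fun t => rot (rot fun p => f p 1) (polar r t))
      (fun t => rot (rot (rot fun p => f p 1)) (polar r t))
      (fun t => rot (fun p => f p 2) (polar r t))
      (fun t => rot (rot fun p => f p 2) (polar r t))
      (fun t => rot (rot (rot fun p => f p 2)) (polar r t))
      (fun t => crossComp f (polar r t) 0)
      (fun t => rot (fun p => crossComp f p 0) (polar r t))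
      (fun t => rot (rot fun p => crossComp f p 0) (polar r t))
      (fun t => crossComp f (polar r t) 1)
      (fun t => rot (fun p => crossComp f p 1) (polar r t))
      (fun t => rot (rot fun p => crossComp f p 1) (polar r t))
      (fun t => crossComp f (polar r t) 2)
      (fun t => rot (fun p => crossComp f p 2) (polar r t))
      (fun t => rot (rot fun p => crossComp f p 2) (polar r t)) := by
  have hx := isQuad_crossComp hU h0 h1 h2
  have hy := isLin_crossComp_one hU h0 h2
  have hz := isLin_crossComp_two hU h0 h1
  have h1' := h1.rot hU h0
  have h2' := h2.rot hU h0
  have key : ∀ {m : ℕ} {H : ℝ × ℝ → ℝ}, OrdOn U m H → ∀ t,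
      HasDerivAt (fun t => H (polar r t)) (rot H (polar r t)) t := fun hH t =>
    hasDerivAt_comp_polar (hH.differentiableAt hU (hr t))
  refine ⟨fun t => ?_, fun t => ?_, fun t => ?_, key (h1'.ordOn hU h0),
    key ((h1'.rot hU h0).ordOn hU h0), key (h2'.ordOn hU h0), key ((h2'.rot hU h0).ordOn hU h0),
    key (hx.ordOn hU h0), key ((hx.rot hU h0).ordOn hU h0), key (hy.ordOn hU h0),
    key ((hy.rot hU h0).ordOn hU h0), key (hz.ordOn hU h0), key ((hz.rot hU h0).ordOn hU h0)⟩
  · refine HasDerivAt.deriv (hasDerivAt_pi.2 fun i => ?_)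
    fin_cases i
    · have : (fun t => curve f r t 0) = fun t => r * Real.cos t := by
        funext t; exact hf0 _ (hr t)
      change HasDerivAt (fun t => curve f r t 0) (-(r * Real.sin t)) t
      rw [this, ← mul_neg]
      exact (Real.hasDerivAt_cos t).const_mul r
    · exact key (h1.ordOn hU h0) t
    · exact key (h2.ordOn hU h0) t
  · rw [crossVec, cross_eq_crossComp hU hf hf0 (hr t)]
    ext i; fin_cases i <;> rfl
  -- The velocity is `-v f_u + u f_v`, a combination of the two factors of the cross product.
  · simp only [rot, crossComp, Matrix.cons_val, polar]
    ring

theorem frameData_hasJet (hU : IsOpen U) (h0 : (0 : ℝ × ℝ) ∈ U) (hf : ContDiffOn ℝ ∞ f U)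
    (hf0 : ∀ p ∈ U, f p 0 = p.1)
    (h1 : IsQuad U (fun p => f p 1) 0 1 0) (h2 : IsQuad U (fun p => f p 2) (a / 2) b (w / 2))
    {r : ℝ} (hr : ∀ t, polar r t ∈ U) (hr0 : r ≠ 0) (θ : ℝ) :
    (frameData hU h0 hf hf0 h1 h2 hr).HasJet θ (jetAt f θ r) := by
  constructor <;> simp only [jetAt] <;> field_simp

/-- Leading terms of `κ̂₂` and `δ` at a fixed angle. -/
theorem exists_near (hU : IsOpen U) (h0 : (0 : ℝ × ℝ) ∈ U) (hf : ContDiffOn ℝ ∞ f U)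
    (hf0 : ∀ p ∈ U, f p 0 = p.1)
    (h1 : IsQuad U (fun p => f p 1) 0 1 0) (h2 : IsQuad U (fun p => f p 2) (a / 2) b (w / 2))
    {θ : ℝ} (hs : Real.sin θ ≠ 0) (hj : 0 < (limitJet a b w (Real.sin θ) (Real.cos θ)).y ^ 2 +
      (limitJet a b w (Real.sin θ) (Real.cos θ)).z ^ 2) :
    (∃ χ, Near χ (Jet.k2 (Real.cos θ) 0 (limitJet a b w (Real.sin θ) (Real.cos θ))) ∧
      ∀ᶠ r in 𝓝[>] 0, kappaHat2 f r θ = r ^ 2 * χ r) ∧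
    ∃ χ, Near χ (Jet.del (Real.sin θ) (Real.cos θ) 0
        (limitJet a b w (Real.sin θ) (Real.cos θ))) ∧
      ∀ᶠ r in 𝓝[>] 0, delta f r θ = r ^ 3 * χ r := by
  have hN := nearJet_jetAt hU h0 h1 h2 θ
  obtain ⟨ε, hε, hball⟩ := Metric.mem_nhds_iff.1 (hU.mem_nhds h0)
  have hev : ∀ᶠ r : ℝ in 𝓝[>] 0, 0 < r ∧ ∀ t, polar r t ∈ U := by
    filter_upwards [Ioo_mem_nhdsGT hε] with r hr
    refine ⟨hr.1, fun t => hball ?_⟩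
    rw [mem_ball_zero_iff]
    exact (norm_polar_le hr.1.le t).trans_lt hr.2
  refine ⟨⟨_, hN.k2 _ hj, ?_⟩, ⟨_, hN.del _ hj hs, ?_⟩⟩
  · filter_upwards [hev] with r hr
    exact (frameData_hasJet hU h0 hf hf0 h1 h2 hr.2 hr.1.ne' θ).kappaHat2_eq hr.1 hs
  · filter_upwards [hev, (hN.norm hj).tendsto.eventually_ne (Jet.norm_zero_pos hj).ne'] with r hr hn
    exact (frameData_hasJet hU h0 hf hf0 h1 h2 hr.2 hr.1.ne' θ).delta_eq hr.1 hs hn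

end

/-! ### The leading coefficients at radius zero -/

theorem second_limitJet {a b w s c : ℝ} :
    Jet.second c (limitJet a b w s c) = c * (w * c ^ 2 + (2 * w + a) * s ^ 2) := by
  simp only [Jet.second, limitJet]
  ring

/-- Both components vanish only if `c = 0` and `w s = 0`, which `w > 0` and `s² + c² = 1` exclude.
-/
theorem limitJet_pos {a b w s c : ℝ} (hw : 0 < w) (h : s ^ 2 + c ^ 2 = 1) :
    0 < (limitJet a b w s c).y ^ 2 + (limitJet a b w s c).z ^ 2 := by
  simp only [limitJet]
  rcases eq_or_ne c 0 with rfl | hc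
  · have : s ≠ 0 := by rintro rfl; norm_num at h
    have : 0 < (w * s) ^ 2 := by positivity
    nlinarith
  · positivity

/-- The first factor is the squared length of the limiting normal, so the zeros come from the
second, which does not involve `a₁₁`. -/
theorem FDelta_eq (a b w θ : ℝ) : FDelta a b w θ =
    ((b * Real.cos θ + w * Real.sin θ) ^ 2 + Real.cos θ ^ 2) *
      ((2 * w + a) * Real.cos θ ^ 2 - (w + 2 * a) * Real.sin θ ^ 2) := by
  simp only [FDelta]
  ring

theorem del_limitJet {a b w θ : ℝ} (hs : Real.sin θ ≠ 0) (hw : 0 < w) :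
    Jet.del (Real.sin θ) (Real.cos θ) 0 (limitJet a b w (Real.sin θ) (Real.cos θ)) =
      FDelta a b w θ * (w * Real.sin θ ^ 2 /
        Jet.norm 0 (limitJet a b w (Real.sin θ) (Real.cos θ)) ^ 5) := by
  have h := Real.sin_sq_add_cos_sq θ
  have hj := limitJet_pos (a := a) (b := b) hw h
  have hn := Jet.norm_zero_pos hj
  have hq : Jet.norm 0 (limitJet a b w (Real.sin θ) (Real.cos θ)) ^ 2 =
      (b * Real.cos θ + w * Real.sin θ) ^ 2 + Real.cos θ ^ 2 := by
    rw [Jet.norm, Real.sq_sqrt (by positivity)]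
    simp only [limitJet]
    ring
  rw [FDelta_eq]
  simp only [Jet.del, Jet.k1, Jet.k2, Jet.k3, Jet.k2', Jet.k3']
  generalize Jet.norm 0 (limitJet a b w (Real.sin θ) (Real.cos θ)) = q at *
  generalize Real.sin θ = s at *
  generalize Real.cos θ = c at *
  have e1 : Jet.second c (limitJet a b w s c) = c * (w * c ^ 2 + (2 * w + a) * s ^ 2) :=
    second_limitJet
  have e2 : Jet.twist s 0 (limitJet a b w s c) = s * (w * (s ^ 2 + c ^ 2)) := by
    simp only [Jet.twist, limitJet]; ring
  rw [h, mul_one] at e2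
  rw [e1, e2]
  -- The powers of `s² + c²` make every term homogeneous of degree 8 in `(s, c)`; the identity then
  -- holds without the relation `s² + c² = 1`.
  have key : -Jet.geod s c 0 (limitJet a b w s c) * w ^ 2 * (s ^ 2 + c ^ 2) ^ 2
      + Jet.second' s c (limitJet a b w s c) * (s * w) * (s ^ 2 + c ^ 2)
        * ((b * c + w * s) ^ 2 + c ^ 2)
      - c * (w * c ^ 2 + (2 * w + a) * s ^ 2) * Jet.twist' s c 0 (limitJet a b w s c)
        * ((b * c + w * s) ^ 2 + c ^ 2)
      + c * (w * c ^ 2 + (2 * w + a) * s ^ 2) * (s * w) * Jet.nu 0 (limitJet a b w s c)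
        * (s ^ 2 + c ^ 2)
      = ((b * c + w * s) ^ 2 + c ^ 2) * ((2 * w + a) * c ^ 2 - (w + 2 * a) * s ^ 2)
        * (w * s ^ 2) * (s ^ 2 + c ^ 2) := by
    simp only [Jet.geod, Jet.second', Jet.twist', Jet.nu, limitJet]
    ring
  rw [h, ← hq] at key
  rw [← hq]
  have hz : (0 : ℝ) ^ 2 = 0 := by norm_num
  simp only [hz, zero_mul, add_zero, zero_add]
  field_simp
  linear_combination key

/-! ### First terms -/

theorem eq_zero_of_isBigO_pow {c : ℝ} {i : ℕ}
    (h : (fun r : ℝ => c * r ^ i) =O[𝓝[>] 0] fun r : ℝ => r ^ (i + 1)) : c = 0 := by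
  have h1 := h.mul (isBigO_refl (fun r : ℝ => (r ^ i)⁻¹) (𝓝[>] 0))
  have h2 : (fun _ : ℝ => c) =O[𝓝[>] 0] fun r : ℝ => r := by
    refine h1.congr' ?_ ?_ <;> filter_upwards [self_mem_nhdsWithin] with r hr <;>
      have hr : r ≠ 0 := ne_of_gt hr
    · field_simp
    · field_simp; ring
  have h0 : Tendsto (fun r : ℝ => r) (𝓝[>] 0) (𝓝 0) := tendsto_nhdsWithin_of_tendsto_nhds tendsto_id
  exact tendsto_nhds_unique tendsto_const_nhds (h2.trans_tendsto h0)

theorem isBigO_pow_of_le {i j : ℕ} (h : i ≤ j) :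
    (fun r : ℝ => r ^ j) =O[𝓝[>] 0] fun r : ℝ => r ^ i := by
  refine IsBigO.of_bound 1 ?_
  filter_upwards [Ioo_mem_nhdsGT one_pos] with r hr
  rw [one_mul, norm_pow, norm_pow, Real.norm_of_nonneg hr.1.le]
  exact pow_le_pow_of_le_one hr.1.le hr.2.le h

/-- If `i < j`, the second expansion gives `x = O(r^(i+1))`, which forces `F x₀ = 0` at every angle,
although `F` is not identically zero. -/
theorem le_of_expansions {x : ℝ → ℝ → ℝ} {F G x₀ : ℝ → ℝ} {i j : ℕ}
    (hx : ∀ θ ∈ Ioo 0 Real.pi, x₀ θ ≠ 0) (hF : ∃ θ ∈ Ioo 0 Real.pi, F θ ≠ 0)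
    (hFx : ∀ θ ∈ Ioo 0 Real.pi,
      (fun r : ℝ => x r θ - F θ * x₀ θ * r ^ i) =O[𝓝[>] 0] fun r : ℝ => r ^ (i + 1))
    (hGx : ∀ θ ∈ Ioo 0 Real.pi,
      (fun r : ℝ => x r θ - G θ * r ^ j) =O[𝓝[>] 0] fun r : ℝ => r ^ (j + 1)) : j ≤ i := by
  by_contra! hij
  obtain ⟨θ, hθ, hne⟩ := hF
  have h2 : (fun r : ℝ => x r θ - G θ * r ^ j) =O[𝓝[>] 0] fun r : ℝ => r ^ (i + 1) :=
    (hGx θ hθ).trans (isBigO_pow_of_le (by omega))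
  have h3 : (fun r : ℝ => G θ * r ^ j) =O[𝓝[>] 0] fun r : ℝ => r ^ (i + 1) :=
    (isBigO_pow_of_le hij).const_mul_left _
  have h4 : (fun r : ℝ => F θ * x₀ θ * r ^ i) =O[𝓝[>] 0] fun r : ℝ => r ^ (i + 1) :=
    ((h2.add h3).sub (hFx θ hθ)).congr_left fun r => by ring
  exact mul_ne_zero hne (hx θ hθ) (eq_zero_of_isBigO_pow h4)

/-- Comparing the expansions in both directions equates the exponents; subtracting them then equates
`F x₀` and `G y₀`. -/
theorem IsFirstTerm.eq_zero_iff {x : ℝ → ℝ → ℝ} {F G : ℝ → ℝ} (hF : IsFirstTerm x F)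
    (hG : IsFirstTerm x G) {θ : ℝ} (hθ : θ ∈ Ioo 0 Real.pi) : F θ = 0 ↔ G θ = 0 := by
  obtain ⟨i, x₀, hx₀, hF0, hFx⟩ := hF
  obtain ⟨j, y₀, hy₀, hG0, hGy⟩ := hG
  obtain rfl : i = j := le_antisymm
    (le_of_expansions (G := fun θ => F θ * x₀ θ) hy₀ hG0 hGy hFx)
    (le_of_expansions (G := fun θ => G θ * y₀ θ) hx₀ hF0 hFx hGy)
  have h := eq_zero_of_isBigO_pow (c := F θ * x₀ θ - G θ * y₀ θ) (i := i)
    (((hGy θ hθ).sub (hFx θ hθ)).congr_left fun r => by ring)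
  constructor
  · intro h0
    simpa [h0, hy₀ θ hθ] using h
  · intro h0
    simpa [h0, hx₀ θ hθ] using h

theorem sin_pos_of_mem {θ : ℝ} (hθ : θ ∈ Ioo 0 Real.pi) : 0 < Real.sin θ :=
  Real.sin_pos_of_pos_of_lt_pi hθ.1 hθ.2

theorem exists_combination_ne {p q : ℝ} (h : p ≠ 0 ∨ q ≠ 0) : ∃ θ ∈ Ioo 0 Real.pi,
    Real.cos θ ≠ 0 ∧ p * Real.cos θ ^ 2 + q * Real.sin θ ^ 2 ≠ 0 := by
  by_contra! H
  have hpi := Real.pi_pos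
  -- The angles `π/3` and `π/6` give the independent equations `p + 3q = 0` and `3p + q = 0`.
  have h3 := H (Real.pi / 3) ⟨by linarith, by linarith⟩ (by rw [Real.cos_pi_div_three]; norm_num)
  have h6 := H (Real.pi / 6) ⟨by linarith, by linarith⟩ (by rw [Real.cos_pi_div_six]; positivity)
  rw [Real.sin_sq, Real.cos_pi_div_three] at h3
  rw [Real.sin_pi_div_six, Real.cos_sq', Real.sin_pi_div_six] at h6
  rcases h with h | h <;> exact h (by linarith)

theorem cross_pos {b w θ : ℝ} (hw : 0 < w) :
    0 < (b * Real.cos θ + w * Real.sin θ) ^ 2 + Real.cos θ ^ 2 := by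
  have := limitJet_pos (a := 0) (b := b) hw (Real.sin_sq_add_cos_sq θ)
  refine this.trans_eq ?_
  simp only [limitJet]
  ring

theorem IsNormalForm.isFirstTerm {f : ℝ × ℝ → Fin 3 → ℝ} {k : ℕ} {b : ℕ → ℝ} {a : ℕ → ℕ → ℝ}
    (h : IsNormalForm f k b a) : IsFirstTerm (kappaHat2 f) (FKappaHat2 (a 2 0) (a 0 2)) ∧
      IsFirstTerm (delta f) (FDelta (a 2 0) (a 1 1) (a 0 2)) := by
  obtain ⟨U, hU, h0, hf, hf0, h1, h2⟩ := h.exists_isQuad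
  have hw := h.a02_pos
  have hj : ∀ θ, 0 < (limitJet (a 2 0) (a 1 1) (a 0 2) (Real.sin θ) (Real.cos θ)).y ^ 2 +
      (limitJet (a 2 0) (a 1 1) (a 0 2) (Real.sin θ) (Real.cos θ)).z ^ 2 :=
    fun θ => limitJet_pos hw (Real.sin_sq_add_cos_sq θ)
  have hn := fun θ => (Jet.norm_zero_pos (hj θ)).ne'
  constructor
  · refine IsFirstTerm.of_near (i := 2) (x₀ := fun θ =>
      (Jet.norm 0 (limitJet (a 2 0) (a 1 1) (a 0 2) (Real.sin θ) (Real.cos θ)))⁻¹)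
      (fun θ _ => inv_ne_zero (hn θ)) ?_ fun θ hθ => ?_
    · obtain ⟨θ, hθ, hc, hne⟩ := exists_combination_ne (q := 2 * a 0 2 + a 2 0) (.inl hw.ne')
      exact ⟨θ, hθ, mul_ne_zero hc hne⟩
    · obtain ⟨⟨χ, hχ, he⟩, -⟩ := exists_near hU h0 hf hf0 h1 h2 (sin_pos_of_mem hθ).ne' (hj θ)
      refine ⟨χ, ?_, he⟩
      rwa [Jet.k2, second_limitJet, div_eq_mul_inv] at hχ
  · refine IsFirstTerm.of_near (i := 3) (x₀ := fun θ => a 0 2 * Real.sin θ ^ 2 /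
      Jet.norm 0 (limitJet (a 2 0) (a 1 1) (a 0 2) (Real.sin θ) (Real.cos θ)) ^ 5)
      (fun θ hθ => ?_) ?_ fun θ hθ => ?_
    · have := sin_pos_of_mem hθ
      have := hn θ
      positivity
    · obtain ⟨θ, hθ, -, hne⟩ := exists_combination_ne (p := 2 * a 0 2 + a 2 0)
        (q := -(a 0 2 + 2 * a 2 0)) (by
          by_contra! H
          linarith [H.1, H.2])
      refine ⟨θ, hθ, ?_⟩
      rw [FDelta_eq]
      exact mul_ne_zero (cross_pos hw).ne' (by rwa [neg_mul, ← sub_eq_add_neg] at hne)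
    · obtain ⟨-, χ, hχ, he⟩ := exists_near hU h0 hf hf0 h1 h2 (sin_pos_of_mem hθ).ne' (hj θ)
      refine ⟨χ, ?_, he⟩
      rwa [del_limitJet (sin_pos_of_mem hθ).ne' hw] at hχ

/-! ### Counting zeros -/

theorem encard_cos_sq_eq {t : ℝ} (h0 : 0 < t) (h1 : t < 1) :
    Set.encard {θ : ℝ | θ ∈ Ioo 0 Real.pi ∧ Real.cos θ ^ 2 = t} = 2 := by
  have hs0 : 0 < √t := Real.sqrt_pos.2 h0
  have hs1 : √t < 1 := by rwa [Real.sqrt_lt' one_pos, one_pow]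
  have hmem : ∀ y : ℝ, -1 < y → y < 1 → Real.arccos y ∈ Ioo 0 Real.pi := fun y h h' =>
    ⟨Real.arccos_pos.2 h', by
      refine lt_of_le_of_ne (Real.arccos_le_pi y) fun he => ?_
      rw [Real.arccos_eq_pi] at he
      linarith⟩
  have : {θ : ℝ | θ ∈ Ioo 0 Real.pi ∧ Real.cos θ ^ 2 = t} =
      {Real.arccos √t, Real.arccos (-√t)} := by
    ext θ
    simp only [mem_ofPred_eq, mem_insert_iff, mem_singleton_iff]
    constructor
    · rintro ⟨hθ, he⟩
      rw [← Real.sq_sqrt h0.le, sq_eq_sq_iff_eq_or_eq_neg] at he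
      exact he.imp (fun h => by rw [← h, Real.arccos_cos hθ.1.le hθ.2.le])
        (fun h => by rw [← h, Real.arccos_cos hθ.1.le hθ.2.le])
    · rintro (rfl | rfl)
      · exact ⟨hmem _ (by linarith) hs1, by
          rw [Real.cos_arccos (by linarith) hs1.le, Real.sq_sqrt h0.le]⟩
      · exact ⟨hmem _ (by linarith) (by linarith), by
          rw [Real.cos_arccos (by linarith) (by linarith), neg_sq, Real.sq_sqrt h0.le]⟩
  rw [this, encard_pair]
  intro he
  have := congrArg Real.cos he
  rw [Real.cos_arccos (by linarith) hs1.le, Real.cos_arccos (by linarith) (by linarith)] at this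
  linarith

theorem encard_combination_eq_two {p q : ℝ} (h : p * q < 0) :
    Set.encard {θ : ℝ | θ ∈ Ioo 0 Real.pi ∧
      p * Real.cos θ ^ 2 + q * Real.sin θ ^ 2 = 0} = 2 := by
  have hp : p ≠ 0 := by rintro rfl; simp at h
  have hd : 0 < (p - q) ^ 2 := by nlinarith [sq_nonneg (p + q)]
  have hd' : q - p ≠ 0 := fun h0 => by
    have : p - q = 0 := by linarith
    simp [this] at hd
  -- Replacing `sin²` by `1 - cos²` turns the equation into `cos² θ = q / (q - p)`, and `pq < 0`
  -- places this value strictly between 0 and 1.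
  rw [← encard_cos_sq_eq (t := q / (q - p))]
  · congr 1
    ext θ
    simp only [mem_ofPred_eq, Real.sin_sq, eq_div_iff hd']
    refine and_congr_right fun _ => ⟨fun h => by linarith, fun h => by linarith⟩
  · rw [show q / (q - p) = (q ^ 2 - p * q) / (q - p) ^ 2 by field_simp]
    have : 0 < (q - p) ^ 2 := by positivity
    have := sq_nonneg q
    exact div_pos (by linarith) (by positivity)
  · rw [← sub_pos, show 1 - q / (q - p) = (p ^ 2 - p * q) / (q - p) ^ 2 by field_simp; ring]
    have := sq_nonneg p
    exact div_pos (by linarith) (by positivity)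

/-- Multiplied by `q`, the form becomes a nonnegative term plus `q² sin² θ > 0`. -/
theorem combination_ne_zero {p q θ : ℝ} (hq : q ≠ 0) (h : 0 ≤ p * q) (hθ : Real.sin θ ≠ 0) :
    p * Real.cos θ ^ 2 + q * Real.sin θ ^ 2 ≠ 0 := by
  intro h0
  have h1 : p * q * Real.cos θ ^ 2 + q ^ 2 * Real.sin θ ^ 2 = 0 := by linear_combination q * h0
  have : 0 < q ^ 2 * Real.sin θ ^ 2 := by positivity
  have : 0 ≤ p * q * Real.cos θ ^ 2 := by positivity
  linarith

theorem encard_combination {p q : ℝ} (hq : q ≠ 0) :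
    Set.encard {θ : ℝ | θ ∈ Ioo 0 Real.pi ∧ p * Real.cos θ ^ 2 + q * Real.sin θ ^ 2 = 0} = 2 ∨
    Set.encard {θ : ℝ | θ ∈ Ioo 0 Real.pi ∧ p * Real.cos θ ^ 2 + q * Real.sin θ ^ 2 = 0} = 0 := by
  rcases lt_or_ge (p * q) 0 with h | h
  · exact .inl (encard_combination_eq_two h)
  · right
    rw [encard_eq_zero, eq_empty_iff_forall_notMem]
    exact fun θ hθ => combination_ne_zero hq h (sin_pos_of_mem hθ.1).ne' hθ.2

theorem cos_ne_zero_iff_of_mem {θ : ℝ} (hθ : θ ∈ Ioo 0 Real.pi) :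
    Real.cos θ ≠ 0 ↔ θ ≠ Real.pi / 2 := by
  rw [not_iff_not]
  constructor
  · intro h
    rw [← Real.arccos_cos hθ.1.le hθ.2.le, h, Real.arccos_zero]
  · rintro rfl
    exact Real.cos_pi_div_two

theorem encard_zeros_FKappaHat2 {a w : ℝ} (hw : 0 < w) :
    Set.encard {θ : ℝ | θ ∈ Ioo 0 Real.pi \ {Real.pi / 2} ∧ FKappaHat2 a w θ = 0} = 2 ∨
    Set.encard {θ : ℝ | θ ∈ Ioo 0 Real.pi \ {Real.pi / 2} ∧ FKappaHat2 a w θ = 0} = 0 := by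
  -- If `2w + a = 0`, the function is `w cos³ θ`, whose only zero is the excluded angle `π/2`.
  rcases eq_or_ne (2 * w + a) 0 with h | h
  · right
    rw [encard_eq_zero, eq_empty_iff_forall_notMem]
    rintro θ ⟨⟨hθ, hne⟩, h0⟩
    have := (cos_ne_zero_iff_of_mem hθ).2 hne
    simp [FKappaHat2, h, this, hw.ne'] at h0
  · convert encard_combination (p := w) h using 3 <;>
    · ext θ
      simp only [mem_ofPred_eq, Set.mem_sdiff, mem_singleton_iff, and_assoc]
      refine and_congr_right fun hθ => ?_
      rw [← ne_eq, ← cos_ne_zero_iff_of_mem hθ, FKappaHat2, mul_eq_zero]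
      -- Where `cos θ = 0` the second factor is `(2w + a) sin² θ ≠ 0`, so removing `π/2` loses none
      -- of its zeros.
      refine ⟨fun H => H.2.resolve_left H.1, fun H => ⟨fun hc => ?_, .inr H⟩⟩
      simp [hc, h, (sin_pos_of_mem hθ).ne'] at H

theorem encard_zeros_FDelta {a b w : ℝ} (hw : 0 < w) (h : w + 2 * a ≠ 0) :
    Set.encard {θ : ℝ | θ ∈ Ioo 0 Real.pi ∧ FDelta a b w θ = 0} = 2 ∨
    Set.encard {θ : ℝ | θ ∈ Ioo 0 Real.pi ∧ FDelta a b w θ = 0} = 0 := by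
  convert encard_combination (p := 2 * w + a) (neg_ne_zero.2 h) using 3 <;>
  · ext θ
    simp only [mem_ofPred_eq, FDelta_eq, mul_eq_zero, (cross_pos hw).ne', false_or, neg_mul,
      ← sub_eq_add_neg]

end WhitneyUmbrella

/-! ### Zero counts for arbitrary first terms -/

theorem mainTheorem4 :
    -- `F_{κ̂₂}` and `F_δ` are first terms of `κ̂₂` and `δ`
    (∀ (f : ℝ × ℝ → Fin 3 → ℝ) (k : ℕ) (b : ℕ → ℝ) (a : ℕ → ℕ → ℝ),
      WhitneyUmbrella.IsNormalForm f k b a →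
        WhitneyUmbrella.IsFirstTerm (WhitneyUmbrella.kappaHat2 f)
          (WhitneyUmbrella.FKappaHat2 (a 2 0) (a 0 2)) ∧
        WhitneyUmbrella.IsFirstTerm (WhitneyUmbrella.delta f)
          (WhitneyUmbrella.FDelta (a 2 0) (a 1 1) (a 0 2))) ∧
    -- (1), for coefficients outside a proper algebraic subset of the `(a₂₀, a₁₁, a₀₂)`-space
    (∃ P : MvPolynomial (Fin 3) ℝ, P ≠ 0 ∧
      ∀ (f : ℝ × ℝ → Fin 3 → ℝ) (k : ℕ) (b : ℕ → ℝ) (a : ℕ → ℕ → ℝ),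
        WhitneyUmbrella.IsNormalForm f k b a →
        MvPolynomial.eval ![a 2 0, a 1 1, a 0 2] P ≠ 0 →
        2 * a 2 0 + a 0 2 < 0 →
        ∀ F : ℝ → ℝ, WhitneyUmbrella.IsFirstTerm (WhitneyUmbrella.kappaHat2 f) F →
          Set.encard {θ : ℝ | θ ∈ Set.Ioo 0 Real.pi \ {Real.pi / 2} ∧ F θ = 0} = 2 ∨
          Set.encard {θ : ℝ | θ ∈ Set.Ioo 0 Real.pi \ {Real.pi / 2} ∧ F θ = 0} = 0) ∧
    -- (2), first part, for coefficients outside a proper algebraic subset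
    (∃ P : MvPolynomial (Fin 3) ℝ, P ≠ 0 ∧
      ∀ (f : ℝ × ℝ → Fin 3 → ℝ) (k : ℕ) (b : ℕ → ℝ) (a : ℕ → ℕ → ℝ),
        WhitneyUmbrella.IsNormalForm f k b a →
        MvPolynomial.eval ![a 2 0, a 1 1, a 0 2] P ≠ 0 →
        2 * a 0 2 + a 2 0 ≠ 0 →
        ∀ F : ℝ → ℝ, WhitneyUmbrella.IsFirstTerm (WhitneyUmbrella.delta f) F →
          Set.encard {θ : ℝ | θ ∈ Set.Ioo 0 Real.pi ∧ F θ = 0} = 4 ∨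
          Set.encard {θ : ℝ | θ ∈ Set.Ioo 0 Real.pi ∧ F θ = 0} = 2 ∨
          Set.encard {θ : ℝ | θ ∈ Set.Ioo 0 Real.pi ∧ F θ = 0} = 0) ∧
    -- (2), second part
    (∀ (f : ℝ × ℝ → Fin 3 → ℝ) (k : ℕ) (b : ℕ → ℝ) (a : ℕ → ℕ → ℝ),
      WhitneyUmbrella.IsNormalForm f k b a →
      2 * a 0 2 + a 2 0 = 0 →
      ∀ F : ℝ → ℝ, WhitneyUmbrella.IsFirstTerm (WhitneyUmbrella.delta f) F →
        ∀ θ ∈ Set.Ioo 0 Real.pi, F θ ≠ 0) := by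
  refine ⟨fun f k b a h => h.isFirstTerm, ⟨1, one_ne_zero, fun f k b a h _ _ F hF => ?_⟩,
    -- This is `a₀₂ + 2a₂₀`; on its zero set `F_δ` has exactly one zero, at `π/2`.
    ⟨MvPolynomial.X 2 + 2 * MvPolynomial.X 0, fun h0 => ?_, fun f k b a h hP _ F hF => ?_⟩,
    fun f k b a h h0 F hF θ hθ hz => ?_⟩
  · have : {θ : ℝ | θ ∈ Set.Ioo 0 Real.pi \ {Real.pi / 2} ∧ F θ = 0} =
        {θ : ℝ | θ ∈ Set.Ioo 0 Real.pi \ {Real.pi / 2} ∧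
          WhitneyUmbrella.FKappaHat2 (a 2 0) (a 0 2) θ = 0} :=
      Set.ext fun θ => and_congr_right fun hθ => hF.eq_zero_iff h.isFirstTerm.1 hθ.1
    rw [this]
    exact WhitneyUmbrella.encard_zeros_FKappaHat2 h.a02_pos
  · simpa using congrArg (MvPolynomial.eval ![0, 0, 1]) h0
  · have : {θ : ℝ | θ ∈ Set.Ioo 0 Real.pi ∧ F θ = 0} = {θ : ℝ | θ ∈ Set.Ioo 0 Real.pi ∧
        WhitneyUmbrella.FDelta (a 2 0) (a 1 1) (a 0 2) θ = 0} :=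
      Set.ext fun θ => and_congr_right fun hθ => hF.eq_zero_iff h.isFirstTerm.2 hθ
    rw [this]
    exact .inr (WhitneyUmbrella.encard_zeros_FDelta h.a02_pos (by simpa using hP))
  · rw [hF.eq_zero_iff h.isFirstTerm.2 hθ, WhitneyUmbrella.FDelta_eq, h0] at hz
    have hw := h.a02_pos
    refine (mul_ne_zero (WhitneyUmbrella.cross_pos hw).ne' ?_) hz
    rw [sub_eq_add_neg, ← neg_mul]
    -- Here `a₂₀ = -2a₀₂`, so `p = 0` and `q = 3a₀₂ > 0`.
    exact WhitneyUmbrella.combination_ne_zero (by linarith) (by simp)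
      (WhitneyUmbrella.sin_pos_of_mem hθ).ne'
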